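/- Let $\mathrm{SO}(2,1)\subset \mathrm{SL}(3,\mathbb{R})$ be the group of real $3\times 3$ matrices of determinant $1$ preserving the quadratic form $x^2+y^2-z^2$. Let $\Gamma\subset \mathrm{SL}(3,\mathbb{R})$ be a discrete subgroup that is Zariski-dense, i.e. every real polynomial in the matrix entries that vanishes on $\Gamma$ vanishes on $\mathrm{SL}(3,\mathbb{R})$. Suppose that for some $g\in\mathrm{SL}(3,\mathbb{R})$ (for instance $g=1$), with $H=g\,\mathrm{SO}(2,1)\,g^{-1}$, the intersection $\Gamma\cap H$ is a lattice in $H$, i.e. it is discrete and $H/(\Gamma\cap H)$ carries an $H$-invariant Borel probability measure. Then $\Gamma$ acts minimally on the manifold $\mathrm{Flag}(\mathbb{R}^3)$ of complete flags of $\mathbb{R}^3$ (equivalently, of pairs $(p,l)$ of a point $p$ and a line $l$ of $\mathbb{P}(\mathbb{R}^3)$ with $p\in l$): every $\Gamma$-orbit in $\mathrm{Flag}(\mathbb{R}^3)$ is dense. -/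

import Mathlib

open scoped LinearAlgebra.Projectivization Matrix MatrixGroups

/-- The special linear group `SL(3, ℝ)`, with the topology induced from the space of matrices. -/
abbrev SL3R : Type := Matrix.SpecialLinearGroup (Fin 3) ℝ

/-- The topology of the real projective plane: the quotient topology from `ℝ³ ∖ {0}`. -/
noncomputable instance projectivePlaneTopology : TopologicalSpace (ℙ ℝ (Fin 3 → ℝ)) :=
  TopologicalSpace.coinduced
    (fun v : {v : Fin 3 → ℝ // v ≠ 0} => Projectivization.mk ℝ v.1 v.2) inferInstance

/-- The space of complete flags of `ℝ³`, seen as pointed projective lines `(p, l)`.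
The first component is the point `p` of `ℙ(ℝ³)`. The second is the line `l`, given as a point
of `ℙ((ℝ³)*)`: covectors are written in coordinates, and `[w]` stands for the projective
line `{[v] | w ⬝ᵥ v = 0}`. The pair is a flag when `p` lies on `l`. -/
def FlagR3 : Type :=
  {x : ℙ ℝ (Fin 3 → ℝ) × ℙ ℝ (Fin 3 → ℝ) // Projectivization.orthogonal x.1 x.2}

/-- The topology of the flag manifold, as a subspace of `ℙ(ℝ³) × ℙ((ℝ³)*)`. -/
noncomputable instance flagTopology : TopologicalSpace FlagR3 :=
  inferInstanceAs (TopologicalSpace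
    {x : ℙ ℝ (Fin 3 → ℝ) × ℙ ℝ (Fin 3 → ℝ) // Projectivization.orthogonal x.1 x.2})

/-- The covector `w ∘ g⁻¹`, in coordinates `(g⁻¹)ᵀ w`, vanishes on `g v` iff `w` vanishes
on `v`. -/
theorem orthogonal_smul_transpose_inv (g : SL3R) (p l : ℙ ℝ (Fin 3 → ℝ))
    (h : Projectivization.orthogonal p l) :
    Projectivization.orthogonal (g • p) ((g⁻¹).transpose • l) := by
  induction p with | h v hv =>
  induction l with | h w hw =>
  rw [Projectivization.smul_mk, Projectivization.smul_mk, Projectivization.orthogonal_mk]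
  rw [Projectivization.orthogonal_mk] at h
  change (g.1 *ᵥ v) ⬝ᵥ ((g⁻¹).1ᵀ *ᵥ w) = 0
  have hg : (g⁻¹).1 * g.1 = 1 := by
    rw [← Matrix.SpecialLinearGroup.coe_mul, inv_mul_cancel, Matrix.SpecialLinearGroup.coe_one]
  rw [Matrix.mulVec_transpose, dotProduct_comm, ← Matrix.dotProduct_mulVec,
    Matrix.mulVec_mulVec, hg, Matrix.one_mulVec, dotProduct_comm, h]

/-- `SL(3, ℝ)` acts on flags by `g • (p, l) = (g p, g l)`; on covectors
`g` acts by `w ↦ w ∘ g⁻¹`, that is, through the matrix `(g⁻¹)ᵀ`. -/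
noncomputable instance flagAction : MulAction SL3R FlagR3 where
  smul g x := ⟨(g • x.1.1, (g⁻¹).transpose • x.1.2),
    orthogonal_smul_transpose_inv g x.1.1 x.1.2 x.2⟩
  one_smul x := by
    have h1 : ((1 : SL3R)⁻¹).transpose = 1 := by
      rw [inv_one]; exact Subtype.ext Matrix.transpose_one
    refine Subtype.ext (Prod.ext (one_smul SL3R x.1.1) ?_)
    change ((1 : SL3R)⁻¹).transpose • x.1.2 = x.1.2
    rw [h1, one_smul]
  mul_smul g h x := by
    have h1 : ((g * h)⁻¹).transpose = (g⁻¹).transpose * (h⁻¹).transpose := by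
      rw [mul_inv_rev]; exact Subtype.ext (Matrix.transpose_mul _ _)
    refine Subtype.ext (Prod.ext (mul_smul g h x.1.1) ?_)
    change ((g * h)⁻¹).transpose • x.1.2 = (g⁻¹).transpose • (h⁻¹).transpose • x.1.2
    rw [h1, mul_smul]

/-- The group `SO(2,1)` of matrices of determinant one preserving the quadratic form
`x² + y² - z²`. -/
def SO21 : Subgroup SL3R where
  carrier := {A | (A : Matrix (Fin 3) (Fin 3) ℝ)ᵀ * Matrix.diagonal ![1, 1, -1] *
    (A : Matrix (Fin 3) (Fin 3) ℝ) = Matrix.diagonal ![1, 1, -1]}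
  one_mem' := by simp
  mul_mem' := by
    intro A B hA hB
    simp only [Set.mem_ofPred_eq] at hA hB ⊢
    rw [Matrix.SpecialLinearGroup.coe_mul, Matrix.transpose_mul]
    calc _ = B.1ᵀ * (A.1ᵀ * Matrix.diagonal ![1, 1, -1] * A.1) * B.1 := by
          simp only [Matrix.mul_assoc]
      _ = _ := by rw [hA, hB]
  inv_mem' := by
    intro A hA
    simp only [Set.mem_ofPred_eq] at hA ⊢
    have h1 : A.1 * (A⁻¹).1 = 1 := by
      rw [← Matrix.SpecialLinearGroup.coe_mul, mul_inv_cancel, Matrix.SpecialLinearGroup.coe_one]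
    have h2 : (A⁻¹).1ᵀ * A.1ᵀ = 1 := by
      rw [← Matrix.transpose_mul, h1, Matrix.transpose_one]
    calc _ = (A⁻¹).1ᵀ * (A.1ᵀ * Matrix.diagonal ![1, 1, -1] * A.1) * (A⁻¹).1 := by rw [hA]
      _ = ((A⁻¹).1ᵀ * A.1ᵀ) * Matrix.diagonal ![1, 1, -1] * (A.1 * (A⁻¹).1) := by
          simp only [Matrix.mul_assoc]
      _ = _ := by rw [h1, h2, Matrix.one_mul, Matrix.mul_one]

/-- A subgroup of `SL(3, ℝ)` is Zariski-dense if every real polynomial in the nine matrix entries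
that vanishes on the subgroup vanishes on all of `SL(3, ℝ)`. -/
def IsZariskiDense (Γ : Subgroup SL3R) : Prop :=
  ∀ f : MvPolynomial (Fin 3 × Fin 3) ℝ,
    (∀ γ ∈ Γ, MvPolynomial.eval (fun ij => γ.1 ij.1 ij.2) f = 0) →
      ∀ g : SL3R, MvPolynomial.eval (fun ij => g.1 ij.1 ij.2) f = 0

/-- A lattice in a topological group `H`: a discrete subgroup `Δ` such that `H ⧸ Δ` carries an
`H`-invariant Borel probability measure. -/
structure IsLatticeIn {H : Type*} [Group H] [TopologicalSpace H] [IsTopologicalGroup H]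
    (Δ : Subgroup H) : Prop where
  discrete : DiscreteTopology Δ
  exists_invariant_measure :
    ∃ μ : @MeasureTheory.Measure (H ⧸ Δ) (borel (H ⧸ Δ)),
      @MeasureTheory.IsProbabilityMeasure (H ⧸ Δ) (borel (H ⧸ Δ)) μ ∧
      ∀ h : H, ∀ B : Set (H ⧸ Δ), @MeasurableSet (H ⧸ Δ) (borel (H ⧸ Δ)) B →
        μ ((fun x => h • x) ⁻¹' B) = μ B

open Filter Topology Matrix

/-! After conjugation by `g⁻¹`, the lattice lies in `SO21` and preserves the conic of null lines.
The form identifies a line with its pole, so a flag becomes a pair `(v, y)` of nonzero vectors with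
`mink v y = 0`. An orbit closure becomes a closed set `F` of pairs, stable under independent
rescaling of both entries and under the group. The goal is that `F` contains every orthogonal pair.

The lattice supplies contraction: by Poincaré recurrence along conjugates of a boost, every rank one
map `rankOne α β` with `α`, `β` null is a limit of multiples of lattice elements
(`rankOne_mem_closure`). Applied to any pair in `F`, these limits give all tangent flags `(α, α)` of
the conic (`IsInvariantCone.diag_mem`).

Zariski density supplies an element whose image of the conic is crossed by a tangent line of the
conic at two points. Indeed, if no null vector became spacelike, every element would preserve the
conic (`mink_mulVec_eq_zero`), a polynomial condition that fails on `SL3R`. Near a crossing, the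
contraction to `α` stretches an arc of the image conic over the whole tangent line at `α`. Hence `F`
contains all flags whose line is tangent (`mem_closure_coneImages`).

The same argument with points and lines exchanged, then once more, fills in the remaining flags
(`IsInvariantCone.mem_of_mink_eq_zero`). No flag escapes, because a point inside the conic lies only
on lines with spacelike pole. -/

/-! ### Lorentzian form, polarity and light cone -/

/-- The Lorentzian bilinear form `x₀ y₀ + x₁ y₁ - x₂ y₂` on `ℝ³`. -/
def mink (v w : Fin 3 → ℝ) : ℝ := v 0 * w 0 + v 1 * w 1 - v 2 * w 2

theorem mink_comm (v w : Fin 3 → ℝ) : mink v w = mink w v := by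
  simp only [mink]; ring

theorem mink_add_right (u v w : Fin 3 → ℝ) : mink u (v + w) = mink u v + mink u w := by
  simp only [mink, Pi.add_apply]; ring

theorem mink_add_left (u v w : Fin 3 → ℝ) : mink (u + v) w = mink u w + mink v w := by
  simp only [mink, Pi.add_apply]; ring

theorem mink_smul_right (c : ℝ) (v w : Fin 3 → ℝ) : mink v (c • w) = c * mink v w := by
  simp only [mink, Pi.smul_apply, smul_eq_mul]; ring

theorem mink_smul_left (c : ℝ) (v w : Fin 3 → ℝ) : mink (c • v) w = c * mink v w := by
  simp only [mink, Pi.smul_apply, smul_eq_mul]; ring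

theorem continuous_mink : Continuous fun p : (Fin 3 → ℝ) × (Fin 3 → ℝ) => mink p.1 p.2 := by
  unfold mink; fun_prop

/-- The polarity of the Lorentzian form: `v ⬝ᵥ polar w = mink v w`. -/
def polar (w : Fin 3 → ℝ) : Fin 3 → ℝ := ![w 0, w 1, -w 2]

theorem continuous_polar : Continuous polar := by
  unfold polar
  refine continuous_pi fun i => ?_
  fin_cases i <;> simp <;> fun_prop

theorem dotProduct_polar (v w : Fin 3 → ℝ) : v ⬝ᵥ polar w = mink v w := by
  simp [polar, mink, dotProduct, Fin.sum_univ_three]; ring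

theorem mink_polar (v w : Fin 3 → ℝ) : mink v (polar w) = v ⬝ᵥ w := by
  simp [polar, mink, dotProduct, Fin.sum_univ_three]

theorem mink_polar_polar (v w : Fin 3 → ℝ) : mink (polar v) (polar w) = mink v w := by
  simp [polar, mink]

theorem polar_polar (w : Fin 3 → ℝ) : polar (polar w) = w := by
  ext i; fin_cases i <;> simp [polar]

theorem polar_smul (c : ℝ) (w : Fin 3 → ℝ) : polar (c • w) = c • polar w := by
  ext i; fin_cases i <;> simp [polar]

theorem polar_ne_zero {w : Fin 3 → ℝ} (hw : w ≠ 0) : polar w ≠ 0 := by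
  intro h
  apply hw
  rw [← polar_polar w, h]
  ext i; fin_cases i <;> simp [polar]

/-- A nonzero vector of the light cone. -/
def IsNull (v : Fin 3 → ℝ) : Prop := v ≠ 0 ∧ mink v v = 0

/-- The endomorphism `v ↦ mink β v • α`. -/
def rankOne (α β : Fin 3 → ℝ) : Matrix (Fin 3) (Fin 3) ℝ := vecMulVec α (polar β)

theorem rankOne_mulVec (α β v : Fin 3 → ℝ) : rankOne α β *ᵥ v = mink β v • α := by
  rw [rankOne, vecMulVec_mulVec, op_smul_eq_smul, dotProduct_comm, dotProduct_polar, mink_comm]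

theorem eq_zero_of_forall_mink {v : Fin 3 → ℝ} (h : ∀ w, mink w v = 0) : v = 0 := by
  have h0 := h ![1, 0, 0]
  have h1 := h ![0, 1, 0]
  have h2 := h ![0, 0, 1]
  simp [mink] at h0 h1 h2
  ext i; fin_cases i <;> simp [*]

/-- Two nonzero functionals do not vanish together on the light cone only by covering it. -/
theorem exists_isNull_mink_ne_zero {a b : Fin 3 → ℝ} (ha : a ≠ 0) (hb : b ≠ 0) :
    ∃ v, IsNull v ∧ mink v a ≠ 0 ∧ mink v b ≠ 0 := by
  -- `mink · a` restricted to the rational parametrization `(1 - s², 2s, 1 + s²)` of the cone. A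
  -- product of two nonzero polynomials has a non-root.
  let P : (Fin 3 → ℝ) → Polynomial ℝ := fun a =>
    Polynomial.C (a 0 - a 2) + Polynomial.C (2 * a 1) * Polynomial.X
      - Polynomial.C (a 0 + a 2) * Polynomial.X ^ 2
  have hP : ∀ a s, (P a).eval s = mink ![1 - s ^ 2, 2 * s, 1 + s ^ 2] a := by
    intro a s; simp [P, mink]; ring
  have hne : ∀ a, a ≠ 0 → P a ≠ 0 := by
    intro a ha h
    apply ha
    have hs : ∀ s : ℝ, a 0 - a 2 + 2 * a 1 * s - (a 0 + a 2) * s ^ 2 = 0 := by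
      intro s
      have := congrArg (Polynomial.eval s) h
      simpa [P] using this
    have e0 := hs 0
    have e1 := hs 1
    have e2 := hs (-1)
    ext i; fin_cases i <;> simp <;> linarith
  by_contra! hcon
  have : P a * P b = 0 := by
    refine Polynomial.funext fun s => ?_
    rw [Polynomial.eval_mul, Polynomial.eval_zero, hP, hP]
    by_cases h : mink ![1 - s ^ 2, 2 * s, 1 + s ^ 2] a = 0
    · rw [h, zero_mul]
    · rw [hcon _ ⟨?_, ?_⟩ h, mul_zero]
      · intro h0
        have := congrFun h0 2
        simp at this
        nlinarith
      · simp [mink]; ring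
  exact (mul_ne_zero (hne a ha) (hne b hb)) this

/-- The light cone is not mapped into the closed solid cone by a linear automorphism and its
inverse unless it is preserved. -/
theorem mink_mulVec_eq_zero {A B : Matrix (Fin 3) (Fin 3) ℝ} (hBA : B * A = 1)
    (hA : ∀ v, IsNull v → mink (A *ᵥ v) (A *ᵥ v) ≤ 0)
    (hB : ∀ v, IsNull v → mink (B *ᵥ v) (B *ᵥ v) ≤ 0) {v : Fin 3 → ℝ} (hv : IsNull v) :
    mink (A *ᵥ v) (A *ᵥ v) = 0 := by
  by_contra hne
  have hw := lt_of_le_of_ne (hA v hv) hne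
  set w := A *ᵥ v with hwdef
  have hBw : B *ᵥ w = v := by rw [hwdef, mulVec_mulVec, hBA, one_mulVec]
  -- A linear form on the spacelike plane of vectors `(p, q, 0)` has a nontrivial kernel. The image
  -- `x` found there is orthogonal to the timelike `w`, hence spacelike.
  obtain ⟨p, q, hpq, h⟩ : ∃ p q : ℝ, 0 < p ^ 2 + q ^ 2 ∧ mink w (A *ᵥ ![p, q, 0]) = 0 := by
    let s := mink w (A *ᵥ ![1, 0, 0])
    let t := mink w (A *ᵥ ![0, 1, 0])
    have hlin : ∀ p q : ℝ, mink w (A *ᵥ ![p, q, 0]) = p * s + q * t := by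
      intro p q
      have : (![p, q, 0] : Fin 3 → ℝ) = p • ![1, 0, 0] + q • ![0, 1, 0] := by
        ext i; fin_cases i <;> simp
      rw [this, mulVec_add, mulVec_smul, mulVec_smul, mink_add_right, mink_smul_right,
        mink_smul_right]
    by_cases hs : s = 0
    · exact ⟨1, 0, by norm_num, by rw [hlin, hs]; ring⟩
    · exact ⟨-t, s, by positivity, by rw [hlin]; ring⟩
  set x := A *ᵥ ![p, q, 0] with hx
  have hBx : B *ᵥ x = ![p, q, 0] := by rw [hx, mulVec_mulVec, hBA, one_mulVec]
  have hx0 : x ≠ 0 := by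
    intro h0
    rw [h0, mulVec_zero] at hBx
    have h1 := congrFun hBx 0
    have h2 := congrFun hBx 1
    simp at h1 h2
    rw [← h1, ← h2] at hpq
    norm_num at hpq
  have hxx : 0 < mink x x := by
    simp only [mink] at hw h ⊢
    have hxs : 0 < x 0 ^ 2 + x 1 ^ 2 + x 2 ^ 2 := by
      by_contra hle
      apply hx0
      have := sq_nonneg (x 0); have := sq_nonneg (x 1); have := sq_nonneg (x 2)
      ext i; fin_cases i <;> simp <;> nlinarith
    have hw2 : 0 < w 2 ^ 2 := by nlinarith [sq_nonneg (w 0), sq_nonneg (w 1)]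
    have hcs : (w 2 * x 2) ^ 2 ≤ (w 0 ^ 2 + w 1 ^ 2) * (x 0 ^ 2 + x 1 ^ 2) := by
      have : w 2 * x 2 = w 0 * x 0 + w 1 * x 1 := by linarith
      rw [this]; nlinarith [sq_nonneg (w 0 * x 1 - w 1 * x 0)]
    by_contra hle
    have h1 : x 0 ^ 2 + x 1 ^ 2 ≤ x 2 ^ 2 := by nlinarith
    have hx2 : 0 < x 2 ^ 2 := by nlinarith
    have h3 : (w 0 ^ 2 + w 1 ^ 2) * (x 0 ^ 2 + x 1 ^ 2) ≤ (w 0 ^ 2 + w 1 ^ 2) * x 2 ^ 2 :=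
      mul_le_mul_of_nonneg_left h1 (by positivity)
    have h4 : (w 0 ^ 2 + w 1 ^ 2) * x 2 ^ 2 < w 2 ^ 2 * x 2 ^ 2 :=
      mul_lt_mul_of_pos_right (by nlinarith) hx2
    nlinarith
  -- With this `a`, both `±a w + x` are null. Their images `±a v + (p, q, 0)` under `B` have norms
  -- averaging to `p² + q² > 0`, so they cannot both be nonpositive.
  obtain ⟨a, ha⟩ : ∃ a : ℝ, a ^ 2 * mink w w + mink x x = 0 := by
    refine ⟨√(mink x x / -mink w w), ?_⟩
    rw [Real.sq_sqrt (div_nonneg hxx.le (by linarith))]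
    field_simp
    ring
  have key : ∀ e : ℝ, e ^ 2 = 1 → 2 * (a * e) * mink v ![p, q, 0] + (p ^ 2 + q ^ 2) ≤ 0 := by
    intro e he
    have hn : IsNull ((a * e) • w + x) := by
      constructor
      · intro h0
        have : mink w ((a * e) • w + x) = 0 := by rw [h0]; simp [mink]
        rw [mink_add_right, mink_smul_right, h, add_zero] at this
        have ha0 : a = 0 := by
          rcases mul_eq_zero.1 this with h1 | h1
          · rcases mul_eq_zero.1 h1 with h1 | h1
            · exact h1
            · rw [h1] at he; norm_num at he
          · exact absurd h1 hne
        rw [ha0] at ha; nlinarith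
      · rw [mink_add_right, mink_add_left, mink_add_left, mink_smul_right, mink_smul_right,
          mink_smul_left, mink_smul_left, mink_comm x w, h]
        linear_combination ha + a ^ 2 * mink w w * he
    have := hB _ hn
    rw [mulVec_add, mulVec_smul, hBw, hBx, mink_add_right, mink_add_left, mink_add_left,
      mink_smul_right, mink_smul_right, mink_smul_left, mink_smul_left, hv.2,
      mink_comm ![p, q, 0] v] at this
    have e2 : mink ![p, q, 0] ![p, q, 0] = p ^ 2 + q ^ 2 := by simp [mink]; ring
    rw [e2] at this
    linarith
  have k1 := key 1 (by norm_num)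
  have k2 := key (-1) (by norm_num)
  nlinarith

/-! ### Arcs of the light cone -/

/-- The rotation of angle `s` around the time axis. -/
noncomputable def rotVec (s : ℝ) (v : Fin 3 → ℝ) : Fin 3 → ℝ :=
  ![Real.cos s * v 0 - Real.sin s * v 1, Real.sin s * v 0 + Real.cos s * v 1, v 2]

theorem continuous_rotVec (v : Fin 3 → ℝ) : Continuous fun s => rotVec s v := by
  unfold rotVec
  refine continuous_pi fun i => ?_
  fin_cases i <;> simp <;> fun_prop

theorem IsNull.rotVec {v : Fin 3 → ℝ} (hv : IsNull v) (s : ℝ) : IsNull (rotVec s v) := by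
  have hm : mink (_root_.rotVec s v) (_root_.rotVec s v) = mink v v := by
    simp [mink, _root_.rotVec]
    linear_combination (v 0 ^ 2 + v 1 ^ 2) * Real.sin_sq_add_cos_sq s
  refine ⟨fun h0 => hv.1 ?_, hm.trans hv.2⟩
  have h2 : v 2 = 0 := by simpa [_root_.rotVec] using congrFun h0 2
  have := hv.2
  simp only [mink, h2] at this
  ext i; fin_cases i <;> simp [h2] <;> nlinarith

/-- The light cone crosses the orthogonal of a spacelike vector `x` along two lines, and `y ∈ x^⊥`
vanishes on at most one of them. -/
theorem exists_isNull_mink_eq_zero {x y : Fin 3 → ℝ} (hx : 0 < mink x x) (hxy : mink x y = 0)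
    (hy : y ≠ 0) : ∃ v, IsNull v ∧ mink x v = 0 ∧ mink y v ≠ 0 := by
  set r := x 0 ^ 2 + x 1 ^ 2 with hr
  set d := √(mink x x) with hd
  have hdd : d ^ 2 = mink x x := Real.sq_sqrt hx.le
  have hd0 : 0 < d := Real.sqrt_pos.2 hx
  have hr0 : 0 < r := by simp only [mink] at hx; nlinarith [sq_nonneg (x 2)]
  have hdr : d ^ 2 = r - x 2 ^ 2 := by rw [hdd, hr, mink]; ring
  -- For `e = ±1`, these span the two null lines of `x^⊥`, normalized to have time coordinate `r`.
  let n : ℝ → Fin 3 → ℝ := fun e =>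
    ![x 2 * x 0 - e * d * x 1, x 2 * x 1 + e * d * x 0, r]
  have hn : ∀ e : ℝ, e ^ 2 = 1 → IsNull (n e) := by
    intro e he
    refine ⟨fun h0 => hr0.ne' (by simpa [n] using congrFun h0 2), ?_⟩
    simp [n, mink]
    linear_combination r * hdr + r * d ^ 2 * he - (x 2 ^ 2 + e ^ 2 * d ^ 2) * hr
  have hxn : ∀ e : ℝ, mink x (n e) = 0 := by
    intro e; simp [n, mink]
    linear_combination (-x 2) * hr
  by_contra! hcon
  have h1 := hcon _ (hn 1 (by norm_num)) (hxn 1)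
  have h2 := hcon _ (hn (-1) (by norm_num)) (hxn (-1))
  simp [n, mink] at h1 h2 hxy
  have h3 : y 0 * x 1 = y 1 * x 0 := by
    have : d * (y 0 * x 1 - y 1 * x 0) = 0 := by linarith
    rcases mul_eq_zero.1 this with h | h
    · exact absurd h hd0.ne'
    · linarith
  have h4 : x 2 * (y 0 * x 0 + y 1 * x 1) = y 2 * r := by linarith
  have h5 : x 0 * y 0 + x 1 * y 1 = x 2 * y 2 := by linarith
  have h6 : y 2 = 0 := by
    have : y 2 * d ^ 2 = 0 := by rw [hdr]; linear_combination -h4 + x 2 * h5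
    rcases mul_eq_zero.1 this with h | h
    · exact h
    · exact absurd h (by positivity)
  apply hy
  rw [h6] at h5
  have h7 : r * y 0 = 0 := by linear_combination y 0 * hr + x 0 * h5 + x 1 * h3
  have h8 : r * y 1 = 0 := by linear_combination y 1 * hr + x 1 * h5 - x 0 * h3
  ext i; fin_cases i
  · simpa [hr0.ne'] using h7
  · simpa [hr0.ne'] using h8
  · simpa using h6

/-- An arc of the light cone along which `mink x` changes sign and `mink y` does not vanish. -/
theorem exists_arc {x y : Fin 3 → ℝ} (hx : 0 < mink x x) (hxy : mink x y = 0)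
    (hy : y ≠ 0) : ∃ (c : ℝ → Fin 3 → ℝ) (ε : ℝ), 0 < ε ∧ Continuous c ∧ (∀ s, IsNull (c s)) ∧
      mink x (c (-ε)) * mink x (c ε) < 0 ∧ ∀ s ∈ Set.Icc (-ε) ε, mink y (c s) ≠ 0 := by
  obtain ⟨v, hv, hxv, hyv⟩ := exists_isNull_mink_eq_zero hx hxy hy
  have hc := continuous_rotVec v
  set D := x 1 * v 0 - x 0 * v 1 with hD
  have hv2 : 0 < v 2 ^ 2 := by
    have h := hv.2
    by_contra hle
    have h2 : v 2 = 0 := by nlinarith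
    simp only [mink, h2] at h
    apply hv.1
    ext i; fin_cases i <;> simp [h2] <;> nlinarith
  have hD2 : 0 < D ^ 2 := by
    have e : D ^ 2 = mink x x * v 2 ^ 2 := by
      have h1 := hv.2
      simp only [mink] at hxv h1 ⊢
      linear_combination (x 0 ^ 2 + x 1 ^ 2) * h1 - (x 0 * v 0 + x 1 * v 1 + x 2 * v 2) * hxv
    rw [e]; positivity
  -- Chosen so that the values of `mink x` at angles `s` and `-s` have product `(1 - cos s) * k s`.
  -- Since `k 0 = -2 D² < 0`, small opposite angles give opposite signs.
  let k : ℝ → ℝ := fun s => (x 2 * v 2) ^ 2 * (1 - Real.cos s) - D ^ 2 * (1 + Real.cos s)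
  have hk : Continuous k := by fun_prop
  have hy' : Continuous fun s => mink y (rotVec s v) :=
    continuous_mink.comp (continuous_const.prodMk hc)
  have hr0 : rotVec 0 v = v := by ext i; fin_cases i <;> simp [rotVec]
  have ev : ∀ᶠ s in 𝓝 (0 : ℝ), k s < 0 ∧ mink y (rotVec s v) ≠ 0 := by
    refine (hk.continuousAt.eventually_lt continuousAt_const ?_).and
      (hy'.continuousAt.eventually_ne ?_)
    · simp [k]; linarith
    · rwa [hr0]
  obtain ⟨ε, hε, hball⟩ := Metric.eventually_nhds_iff.1 ev
  refine ⟨fun s => rotVec s v, min (ε / 2) 1, by positivity, hc, hv.rotVec, ?_, ?_⟩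
  · set t := min (ε / 2) 1
    have ht0 : 0 < t := by positivity
    have ht1 : t ≤ 1 := min_le_right _ _
    have htε : t < ε := (min_le_left _ _).trans_lt (by linarith)
    have hkt := (hball (y := t) (by rw [Real.dist_eq, sub_zero, abs_of_pos ht0]; exact htε)).1
    have hcos : 0 < 1 - Real.cos t := by
      have := Real.cos_lt_cos_of_nonneg_of_le_pi le_rfl (by linarith [Real.pi_gt_three]) ht0
      rw [Real.cos_zero] at this; linarith
    have e : mink x (rotVec (-t) v) * mink x (rotVec t v) = (1 - Real.cos t) * k t := by
      simp [mink, rotVec, k]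
      simp only [mink] at hxv
      have hs := Real.sin_sq_add_cos_sq t
      have hz : x 0 * v 0 + x 1 * v 1 = x 2 * v 2 := by linarith
      have e1 : x 0 * (Real.cos t * v 0 + Real.sin t * v 1)
          + x 1 * (-(Real.sin t * v 0) + Real.cos t * v 1) - x 2 * v 2
          = -(x 2 * v 2) * (1 - Real.cos t) - D * Real.sin t := by
        linear_combination Real.cos t * hz + Real.sin t * hD
      have e2 : x 0 * (Real.cos t * v 0 - Real.sin t * v 1)
          + x 1 * (Real.sin t * v 0 + Real.cos t * v 1) - x 2 * v 2
          = -(x 2 * v 2) * (1 - Real.cos t) + D * Real.sin t := by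
        linear_combination Real.cos t * hz - Real.sin t * hD
      rw [e1, e2]
      linear_combination -D ^ 2 * hs
    rw [e]
    exact mul_neg_of_pos_of_neg hcos hkt
  · intro s hs
    refine (hball ?_).2
    rw [Real.dist_eq, sub_zero]
    refine (abs_le.2 ⟨hs.1, hs.2⟩).trans_lt ((min_le_left _ _).trans_lt (by linarith))

/-! ### Cross products and limits -/

/-- A point common to two projective lines is their cross product. Expressing the product through
the point, with `k` possibly zero, avoids assuming the lines distinct. -/
theorem exists_cross_eq_smul {q w m : Fin 3 → ℝ} (hq : q ≠ 0) (hw : q ⬝ᵥ w = 0)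
    (hm : q ⬝ᵥ m = 0) : ∃ k : ℝ, w ⨯₃ m = k • q := by
  have hqq : q ⬝ᵥ q ≠ 0 := fun h => hq (dotProduct_self_eq_zero.1 h)
  refine ⟨(q ⬝ᵥ q)⁻¹ * (q ⬝ᵥ w ⨯₃ m), ?_⟩
  rw [mul_smul, eq_inv_smul_iff₀ hqq]
  simp only [dotProduct, Fin.sum_univ_three] at hw hm
  ext i
  fin_cases i <;> simp [cross_apply, dotProduct, Fin.sum_univ_three]
  · linear_combination (q 1 * m 2 - q 2 * m 1) * hw + (q 2 * w 1 - q 1 * w 2) * hm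
  · linear_combination (q 2 * m 0 - q 0 * m 2) * hw + (q 0 * w 2 - q 2 * w 0) * hm
  · linear_combination (q 0 * m 1 - q 1 * m 0) * hw + (q 1 * w 0 - q 0 * w 1) * hm

theorem exists_cross_eq {v m : Fin 3 → ℝ} (hm : m ≠ 0) (h : v ⬝ᵥ m = 0) :
    ∃ w, w ⨯₃ m = v := by
  have hmm : m ⬝ᵥ m ≠ 0 := fun h => hm (dotProduct_self_eq_zero.1 h)
  refine ⟨(m ⬝ᵥ m)⁻¹ • m ⨯₃ v, ?_⟩
  rw [map_smul, LinearMap.smul_apply, cross_cross_eq_smul_sub_smul, h, zero_smul, sub_zero,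
    smul_smul, inv_mul_cancel₀ hmm, one_smul]

theorem tendsto_mulVec {ι : Type*} {l : Filter ι} {M : ι → Matrix (Fin 3) (Fin 3) ℝ}
    {M₀ : Matrix (Fin 3) (Fin 3) ℝ} {v : ι → Fin 3 → ℝ} {v₀ : Fin 3 → ℝ}
    (hM : Tendsto M l (𝓝 M₀)) (hv : Tendsto v l (𝓝 v₀)) :
    Tendsto (fun i => M i *ᵥ v i) l (𝓝 (M₀ *ᵥ v₀)) :=
  ((continuous_fst.matrix_mulVec continuous_snd :
    Continuous fun p : Matrix (Fin 3) (Fin 3) ℝ × (Fin 3 → ℝ) => p.1 *ᵥ p.2).tendsto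
      (M₀, v₀)).comp (hM.prodMk_nhds hv)

theorem continuous_cross : Continuous fun p : (Fin 3 → ℝ) × (Fin 3 → ℝ) => p.1 ⨯₃ p.2 := by
  simp only [cross_apply]
  refine continuous_pi fun i => ?_
  fin_cases i <;> simp <;> fun_prop

/-! ### Stretching an arc over a tangent line -/

/-- The pairs of matrices in `G` are contragredient to each other for the Lorentzian form. -/
def Contragredient (G : Set (Matrix (Fin 3) (Fin 3) ℝ × Matrix (Fin 3) (Fin 3) ℝ)) : Prop :=
  ∀ P ∈ G, ∀ v w, mink (P.1 *ᵥ v) (P.2 *ᵥ w) = mink v w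

/-- Every rank one endomorphism `v ↦ mink β v • α` with `α`, `β` null is a limit of multiples of
Lorentzian isometries in `G`. -/
def HasRankOneLimits (G : Set (Matrix (Fin 3) (Fin 3) ℝ × Matrix (Fin 3) (Fin 3) ℝ)) : Prop :=
  ∀ α β, IsNull α → IsNull β →
    rankOne α β ∈ closure {M | ∃ (c : ℝ) (δ : Matrix (Fin 3) (Fin 3) ℝ), (δ, δ) ∈ G ∧ M = c • δ}

theorem HasRankOneLimits.exists_seq
    {G : Set (Matrix (Fin 3) (Fin 3) ℝ × Matrix (Fin 3) (Fin 3) ℝ)} (hR : HasRankOneLimits G)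
    {α β : Fin 3 → ℝ} (hα : IsNull α) (hβ : IsNull β) :
    ∃ M : ℕ → Matrix (Fin 3) (Fin 3) ℝ,
      (∀ n, ∃ (c : ℝ) (δ : Matrix (Fin 3) (Fin 3) ℝ), (δ, δ) ∈ G ∧ M n = c • δ) ∧
      Tendsto M atTop (𝓝 (rankOne α β)) :=
  (mem_closure_iff_seq_limit (X := Fin 3 → Fin 3 → ℝ)).1 (hR α β hα hβ)

/-- `A` maps some null vector to the null vector that `A'` makes out of a spacelike vector. -/
def IsTransverse (A A' : Matrix (Fin 3) (Fin 3) ℝ) : Prop :=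
  ∃ x y, IsNull (A' *ᵥ x) ∧ A *ᵥ y = A' *ᵥ x ∧ 0 < mink x x

theorem mulVec_ne_zero_left {A A' : Matrix (Fin 3) (Fin 3) ℝ}
    (h : ∀ v w, mink (A *ᵥ v) (A' *ᵥ w) = mink v w) {v : Fin 3 → ℝ} (hv : v ≠ 0) :
    A *ᵥ v ≠ 0 := by
  intro h0
  apply hv
  refine eq_zero_of_forall_mink fun w => ?_
  rw [mink_comm, ← h v w, h0]; simp [mink]

theorem mulVec_surjective_right {A A' : Matrix (Fin 3) (Fin 3) ℝ}
    (h : ∀ v w, mink (A *ᵥ v) (A' *ᵥ w) = mink v w) : Function.Surjective (A' *ᵥ ·) := by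
  rw [mulVec_surjective_iff_isUnit, ← mulVec_injective_iff_isUnit]
  intro v w hvw
  by_contra hne
  refine mulVec_ne_zero_left (A := A') (A' := A) (fun v w => ?_) (sub_ne_zero.2 hne) ?_
  · rw [mink_comm, h, mink_comm]
  · rw [mulVec_sub]; exact sub_eq_zero.2 hvw

variable {G : Set (Matrix (Fin 3) (Fin 3) ℝ × Matrix (Fin 3) (Fin 3) ℝ)}

/-- The images of the light cone under multiples of `δ A` and `δ A'`, for `δ` an isometry
in `G`. -/
def coneImages (G : Set (Matrix (Fin 3) (Fin 3) ℝ × Matrix (Fin 3) (Fin 3) ℝ))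
    (A A' : Matrix (Fin 3) (Fin 3) ℝ) : Set ((Fin 3 → ℝ) × (Fin 3 → ℝ)) :=
  {p | ∃ (δ : Matrix (Fin 3) (Fin 3) ℝ) (v : Fin 3 → ℝ) (c d : ℝ), (δ, δ) ∈ G ∧ IsNull v ∧
    p = (c • (δ *ᵥ A *ᵥ v), d • (δ *ᵥ A' *ᵥ v))}

/-- Along an arc `c` of the cone, the maps `M n` tending to `rankOne α β` send `A (c s)` close to
`mink x (c s) • α`, whose coefficient changes sign. The intermediate value theorem finds a point of
the image curve in the plane `w^⊥`. Meanwhile the line through it tends to the tangent at `α`,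
because the coefficient `mink y (c s)` stays nonzero. The point therefore tends to the intersection
of `w^⊥` with this tangent. -/
theorem cross_mem_closure_coneImages (hG : Contragredient G) (hR : HasRankOneLimits G)
    {A A' : Matrix (Fin 3) (Fin 3) ℝ} (hA : ∀ v w, mink (A *ᵥ v) (A' *ᵥ w) = mink v w)
    (hT : IsTransverse A A') {α w : Fin 3 → ℝ} (hα : IsNull α) (hw : w ⬝ᵥ α ≠ 0) :
    (w ⨯₃ polar α, α) ∈ closure (coneImages G A A') := by
  obtain ⟨x, y, hβ, hy, hx⟩ := hT
  set β := A' *ᵥ x with hβdef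
  have hxy : mink x y = 0 := by rw [mink_comm, ← hA, hy]; exact hβ.2
  have hy0 : y ≠ 0 := by
    rintro rfl
    rw [mulVec_zero] at hy
    exact hβ.1 hy.symm
  obtain ⟨c, ε, hε, hc, hnull, hsign, hyc⟩ := exists_arc hx hxy hy0
  have hβA : ∀ v, mink β (A *ᵥ v) = mink x v := fun v => by
    rw [hβdef, mink_comm, hA, mink_comm]
  have hβA' : ∀ v, mink β (A' *ᵥ v) = mink y v := fun v => by rw [← hy, hA]
  obtain ⟨M, hM, hlim⟩ := hR.exists_seq hα hβ
  let g : ℕ → ℝ → ℝ := fun n s => w ⬝ᵥ (M n *ᵥ A *ᵥ c s)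
  have hg : ∀ n, Continuous (g n) := fun n => by fun_prop
  have hgl : ∀ s, Tendsto (fun n => g n s) atTop (𝓝 (mink x (c s) * (w ⬝ᵥ α))) := by
    intro s
    have h1 := tendsto_mulVec hlim (tendsto_const_nhds (x := A *ᵥ c s))
    rw [rankOne_mulVec, hβA] at h1
    have h2 : Continuous fun u : Fin 3 → ℝ => w ⬝ᵥ u := by fun_prop
    have h3 := (h2.tendsto _).comp h1
    rwa [dotProduct_smul, smul_eq_mul] at h3
  -- The limit of the product is the negative number `hsign` times `(w ⬝ᵥ α)²`.
  have hneg : ∀ᶠ n in atTop, g n (-ε) * g n ε < 0 := by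
    refine ((hgl (-ε)).mul (hgl ε)).eventually_lt_const ?_
    have := mul_neg_of_neg_of_pos hsign (pow_pos (abs_pos.2 hw) 2)
    rw [sq_abs] at this
    linarith
  obtain ⟨N, hN⟩ := eventually_atTop.1 hneg
  have hroot : ∀ n, ∃ s ∈ Set.Icc (-ε) ε, g (n + N) s = 0 := by
    intro n
    have hn := hN (n + N) (Nat.le_add_left _ _)
    have h0 : (0 : ℝ) ∈ Set.uIcc (g (n + N) (-ε)) (g (n + N) ε) := by
      rw [Set.mem_uIcc]
      rcases mul_neg_iff.1 hn with h | h
      · exact Or.inr ⟨h.2.le, h.1.le⟩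
      · exact Or.inl ⟨h.1.le, h.2.le⟩
    obtain ⟨s, hs, hs0⟩ := intermediate_value_uIcc (hg (n + N)).continuousOn h0
    rw [Set.uIcc_of_le (by linarith)] at hs
    exact ⟨s, hs, hs0⟩
  choose s hs hs0 using hroot
  -- Convergent roots let the poles be rescaled by the constant `κ⁻¹`, so that they tend to `α`
  -- itself.
  obtain ⟨t, ht, φ, hφ, hst⟩ := isCompact_Icc.tendsto_subseq hs
  set κ := mink y (c t) with hκ
  have hκ0 : κ ≠ 0 := hyc t ht
  have hMφ : Tendsto (fun n => M (φ n + N)) atTop (𝓝 (rankOne α β)) :=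
    hlim.comp ((tendsto_add_atTop_nat N).comp hφ.tendsto_atTop)
  let z : ℕ → Fin 3 → ℝ := fun n => κ⁻¹ • (M (φ n + N) *ᵥ A' *ᵥ c (s (φ n)))
  have hz : Tendsto z atTop (𝓝 α) := by
    have hcs : Tendsto (fun n => A' *ᵥ c (s (φ n))) atTop (𝓝 (A' *ᵥ c t)) :=
      tendsto_mulVec tendsto_const_nhds ((hc.tendsto t).comp hst)
    have h1 := (tendsto_mulVec hMφ hcs).const_smul κ⁻¹
    rwa [rankOne_mulVec, hβA', smul_smul, inv_mul_cancel₀ hκ0, one_smul] at h1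
  have hzw : Tendsto (fun n => (w ⨯₃ polar (z n), z n)) atTop (𝓝 (w ⨯₃ polar α, α)) :=
    ((continuous_cross.comp (continuous_const.prodMk continuous_polar)).tendsto α
      |>.comp hz).prodMk_nhds hz
  refine mem_closure_of_tendsto hzw (Eventually.of_forall fun n => ?_)
  obtain ⟨a, δ, hδ, hMa⟩ := hM (φ n + N)
  have hn := hN (φ n + N) (Nat.le_add_left _ _)
  have ha : a ≠ 0 := by
    rintro rfl
    simp [g, hMa] at hn
  have hz' : z n = (κ⁻¹ * a) • (δ *ᵥ A' *ᵥ c (s (φ n))) := by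
    simp only [z, hMa, smul_mulVec, smul_smul]
  have hq0 : δ *ᵥ A *ᵥ c (s (φ n)) ≠ 0 :=
    mulVec_ne_zero_left (hG _ hδ) (mulVec_ne_zero_left hA (hnull _).1)
  have hqw : (δ *ᵥ A *ᵥ c (s (φ n))) ⬝ᵥ w = 0 := by
    have h := hs0 (φ n)
    simp only [g, hMa, smul_mulVec, dotProduct_smul, smul_eq_mul] at h
    rw [dotProduct_comm]
    exact (mul_eq_zero.1 h).resolve_left ha
  have hqz : (δ *ᵥ A *ᵥ c (s (φ n))) ⬝ᵥ polar (z n) = 0 := by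
    rw [dotProduct_polar, hz', mink_smul_right, hG _ hδ, hA, (hnull _).2, mul_zero]
  -- The point lies on both `w^⊥` and its own line, of covector `polar (z n)`, so `w ⨯₃ polar (z n)`
  -- is a multiple of it.
  obtain ⟨k, hk⟩ := exists_cross_eq_smul hq0 hqw hqz
  exact ⟨δ, c (s (φ n)), k, κ⁻¹ * a, hδ, hnull _, by rw [hk, hz']⟩

theorem mem_closure_coneImages (hG : Contragredient G) (hR : HasRankOneLimits G)
    {A A' : Matrix (Fin 3) (Fin 3) ℝ} (hA : ∀ v w, mink (A *ᵥ v) (A' *ᵥ w) = mink v w)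
    (hT : IsTransverse A A') {v α : Fin 3 → ℝ} (hα : IsNull α) (hv : mink v α = 0) :
    (v, α) ∈ closure (coneImages G A A') := by
  obtain ⟨w, rfl⟩ := exists_cross_eq (polar_ne_zero hα.1) ((dotProduct_polar v α).trans hv)
  have hαα : α ⬝ᵥ α ≠ 0 := fun h => hα.1 (dotProduct_self_eq_zero.1 h)
  -- The previous lemma needs `w ⬝ᵥ α ≠ 0`; otherwise `w` is perturbed in the direction of `α`.
  by_cases hw : w ⬝ᵥ α = 0
  · have hlim : Tendsto (fun ε : ℝ => ((w + ε • α) ⨯₃ polar α, α)) (𝓝[≠] 0)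
        (𝓝 (w ⨯₃ polar α, α)) := by
      have hc : Continuous fun ε : ℝ => ((w + ε • α) ⨯₃ polar α, α) :=
        (continuous_cross.comp ((by fun_prop : Continuous fun ε : ℝ => w + ε • α).prodMk
          continuous_const)).prodMk continuous_const
      have := (hc.tendsto 0).mono_left (nhdsWithin_le_nhds (s := {0}ᶜ))
      simpa only [zero_smul, add_zero] using this
    rw [← closure_closure]
    refine mem_closure_of_tendsto hlim ?_
    filter_upwards [self_mem_nhdsWithin] with ε hε
    refine cross_mem_closure_coneImages hG hR hA hT hα ?_
    rw [add_dotProduct, smul_dotProduct, hw, zero_add]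
    exact mul_ne_zero hε hαα
  · exact cross_mem_closure_coneImages hG hR hA hT hα hw

/-! ### Closed invariant cones contain every flag -/

/-- A closed set of pairs of vectors, invariant under `G` and under rescaling. -/
structure IsInvariantCone (G : Set (Matrix (Fin 3) (Fin 3) ℝ × Matrix (Fin 3) (Fin 3) ℝ))
    (F : Set ((Fin 3 → ℝ) × (Fin 3 → ℝ))) : Prop where
  closed : IsClosed F
  smul : ∀ (c d : ℝ) (v y : Fin 3 → ℝ), (v, y) ∈ F → (c • v, d • y) ∈ F
  map : ∀ P ∈ G, ∀ v y, (v, y) ∈ F → (P.1 *ᵥ v, P.2 *ᵥ y) ∈ F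

theorem IsInvariantCone.swap {F : Set ((Fin 3 → ℝ) × (Fin 3 → ℝ))} (hF : IsInvariantCone G F) :
    IsInvariantCone (Prod.swap ⁻¹' G) (Prod.swap ⁻¹' F) where
  closed := hF.closed.preimage continuous_swap
  smul c d v y h := hF.smul d c y v h
  map _ hP v y h := hF.map _ hP y v h

theorem Contragredient.swap (hG : Contragredient G) : Contragredient (Prod.swap ⁻¹' G) :=
  fun P hP v w => by rw [mink_comm, mink_comm v]; exact hG _ hP w v

theorem exists_isNull_mink_eq_zero_of_nonneg {v : Fin 3 → ℝ} (hv : v ≠ 0) (h : 0 ≤ mink v v) :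
    ∃ α, IsNull α ∧ mink v α = 0 := by
  rcases h.eq_or_lt with h | h
  · exact ⟨v, ⟨hv, h.symm⟩, h.symm⟩
  · obtain ⟨α, hα, hvα, -⟩ := exists_isNull_mink_eq_zero (y := ![v 1, -v 0, 0]) h
      (by simp [mink]; ring) (by
        intro h0
        have h1 := congrFun h0 0
        have h2 := congrFun h0 1
        simp at h1 h2
        simp only [mink, h1, h2] at h
        nlinarith [sq_nonneg (v 2)])
    exact ⟨α, hα, hvα⟩

/-- Limits `rankOne α β` with `β` orthogonal to neither `v` nor `y` collapse both entries onto the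
line of `α`. -/
theorem IsInvariantCone.diag_mem {F : Set ((Fin 3 → ℝ) × (Fin 3 → ℝ))}
    (hF : IsInvariantCone G F) (hR : HasRankOneLimits G) {v y : Fin 3 → ℝ} (hvy : (v, y) ∈ F)
    (hv : v ≠ 0) (hy : y ≠ 0) {α : Fin 3 → ℝ} (hα : IsNull α) : (α, α) ∈ F := by
  obtain ⟨β, hβ, hβv, hβy⟩ := exists_isNull_mink_ne_zero hv hy
  obtain ⟨M, hM, hlim⟩ := hR.exists_seq hα hβ
  have h1 := tendsto_mulVec hlim (tendsto_const_nhds (x := v))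
  have h2 := tendsto_mulVec hlim (tendsto_const_nhds (x := y))
  rw [rankOne_mulVec] at h1 h2
  have h3 : (mink β v • α, mink β y • α) ∈ F := by
    refine hF.closed.mem_of_tendsto (h1.prodMk_nhds h2) (Eventually.of_forall fun n => ?_)
    obtain ⟨a, δ, hδ, hMa⟩ := hM n
    simp only [hMa, smul_mulVec]
    exact hF.smul _ _ _ _ (hF.map _ hδ _ _ hvy)
  have h4 := hF.smul (mink β v)⁻¹ (mink β y)⁻¹ _ _ h3
  rwa [inv_smul_smul₀ hβv, inv_smul_smul₀ hβy] at h4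

/-- If `F` contains all the pairs `(v, y)` with `mink v y = 0` for `v` null, then it does for `v`
spacelike. -/
theorem IsInvariantCone.mem_of_nonneg {F : Set ((Fin 3 → ℝ) × (Fin 3 → ℝ))}
    (hF : IsInvariantCone G F) (hG : Contragredient G) (hR : HasRankOneLimits G)
    {A A' : Matrix (Fin 3) (Fin 3) ℝ} (hA : (A, A') ∈ G) (hT : IsTransverse A A')
    (hnull : ∀ α y, IsNull α → mink α y = 0 → (α, y) ∈ F) {v y : Fin 3 → ℝ} (hv : v ≠ 0)
    (hvv : 0 ≤ mink v v) (hvy : mink v y = 0) : (v, y) ∈ F := by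
  -- For `v ≠ 0`, the vectors `polar (v ⨯₃ u)` are exactly those orthogonal to `v`. This
  -- parametrization makes containing the whole pencil through `v` a closed condition on `v`.
  let S : Set (Fin 3 → ℝ) := {v | ∀ u, (v, polar (v ⨯₃ u)) ∈ F}
  have hS : IsClosed S := by
    have : S = ⋂ u, (fun v => (v, polar (v ⨯₃ u))) ⁻¹' F := by ext; simp [S]
    rw [this]
    exact isClosed_iInter fun u => hF.closed.preimage (continuous_id.prodMk
      (continuous_polar.comp (continuous_cross.comp (continuous_id.prodMk continuous_const))))
  have hmap : ∀ P ∈ G, ∀ v, (∀ y, mink v y = 0 → (v, y) ∈ F) →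
      ∀ y, mink (P.1 *ᵥ v) y = 0 → (P.1 *ᵥ v, y) ∈ F := by
    intro P hP v h y hy
    obtain ⟨z, rfl⟩ := mulVec_surjective_right (hG P hP) y
    rw [hG P hP] at hy
    exact hF.map P hP v z (h z hy)
  obtain ⟨α, hα, hvα⟩ := exists_isNull_mink_eq_zero_of_nonneg hv hvv
  have hvS : v ∈ S := by
    -- Only the point component matters: the points `δ A z`, with `z` null, accumulate at `v`, and
    -- their full pencils lie in `F` by invariance.
    have h1 := mem_closure_coneImages hG hR (hG _ hA) hT hα hvα
    have h2 : v ∈ closure (Prod.fst '' coneImages G A A') :=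
      image_closure_subset_closure_image continuous_fst ⟨_, h1, rfl⟩
    refine closure_minimal ?_ hS h2
    rintro _ ⟨_, ⟨δ, z, c, d, hδ, hz, rfl⟩, rfl⟩ u
    have h3 : (δ *ᵥ A *ᵥ z, polar ((δ *ᵥ A *ᵥ z) ⨯₃ u)) ∈ F :=
      hmap _ hδ _ (hmap _ hA z fun y => hnull z y hz) _ (by rw [mink_polar, dot_self_cross])
    simp only [map_smul, LinearMap.smul_apply, polar_smul]
    exact hF.smul _ _ _ _ h3
  obtain ⟨w, hw⟩ := exists_cross_eq (v := polar y) hv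
    (by rw [dotProduct_comm, dotProduct_polar, hvy])
  have := hvS (-w)
  rwa [map_neg, cross_anticomm, hw, polar_polar] at this

/-- Cauchy–Schwarz on the two space coordinates. -/
theorem nonneg_of_mink_eq_zero {v y : Fin 3 → ℝ} (hv : v ≠ 0) (hvv : mink v v ≤ 0)
    (hvy : mink v y = 0) : 0 ≤ mink y y := by
  simp only [mink] at *
  have h2 : 0 < v 2 ^ 2 := by
    by_contra hle
    have h2 : v 2 = 0 := by nlinarith
    rw [h2] at hvv
    apply hv
    ext i; fin_cases i <;> simp [h2] <;> nlinarith
  have h3 : (v 2 * y 2) ^ 2 ≤ (v 0 ^ 2 + v 1 ^ 2) * (y 0 ^ 2 + y 1 ^ 2) := by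
    have : v 2 * y 2 = v 0 * y 0 + v 1 * y 1 := by linarith
    rw [this]; nlinarith [sq_nonneg (v 0 * y 1 - v 1 * y 0)]
  have h4 : (v 0 ^ 2 + v 1 ^ 2) * (y 0 ^ 2 + y 1 ^ 2) ≤ v 2 ^ 2 * (y 0 ^ 2 + y 1 ^ 2) :=
    mul_le_mul_of_nonneg_right (by linarith) (by positivity)
  have h5 : y 2 ^ 2 ≤ y 0 ^ 2 + y 1 ^ 2 := by
    rw [mul_pow] at h3
    exact le_of_mul_le_mul_left (h3.trans h4) h2
  linarith

/-- Tangent flags spread to all flags with null pole (`s2`), then by duality to all with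
non-timelike pole (`s3`). These include every flag with null point, so a second spreading covers the
non-timelike points; a timelike point only has spacelike poles. -/
theorem IsInvariantCone.mem_of_mink_eq_zero {F : Set ((Fin 3 → ℝ) × (Fin 3 → ℝ))}
    (hF : IsInvariantCone G F) (hG : Contragredient G) (hR : HasRankOneLimits G)
    (h₁ : ∃ P ∈ G, IsTransverse P.1 P.2) (h₂ : ∃ P ∈ G, IsTransverse P.2 P.1)
    {v₀ y₀ : Fin 3 → ℝ} (h₀ : (v₀, y₀) ∈ F) (hv₀ : v₀ ≠ 0) (hy₀ : y₀ ≠ 0)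
    {v y : Fin 3 → ℝ} (hv : v ≠ 0) (hy : y ≠ 0) (hvy : mink v y = 0) : (v, y) ∈ F := by
  obtain ⟨⟨A, A'⟩, hA, hT⟩ := h₁
  obtain ⟨⟨B', B⟩, hB, hT'⟩ := h₂
  have s2 : ∀ α v, IsNull α → mink α v = 0 → (v, α) ∈ F := by
    intro α v hα hv
    rw [mink_comm] at hv
    refine closure_minimal ?_ hF.closed (mem_closure_coneImages hG hR (hG _ hA) hT hα hv)
    rintro _ ⟨δ, z, c, d, hδ, hz, rfl⟩
    exact hF.smul _ _ _ _ (hF.map _ hδ _ _ (hF.map _ hA _ _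
      (hF.diag_mem hR h₀ hv₀ hy₀ hz)))
  have s3 : ∀ {v y}, y ≠ 0 → 0 ≤ mink y y → mink v y = 0 → (v, y) ∈ F := by
    intro v y hy hyy hvy
    rw [mink_comm] at hvy
    exact hF.swap.mem_of_nonneg (A := B) (A' := B') hG.swap hR hB hT' s2 hy hyy hvy
  rcases le_total 0 (mink v v) with h | h
  · refine hF.mem_of_nonneg hG hR hA hT (fun α y hα hαy => ?_) hv h hvy
    by_cases hy0 : y = 0
    · subst hy0
      have := hF.smul 1 0 _ _ (hF.diag_mem hR h₀ hv₀ hy₀ hα)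
      rwa [one_smul, zero_smul] at this
    · exact s3 hy0 (nonneg_of_mink_eq_zero hα.1 hα.2.le hαy) hαy
  · exact s3 hy (nonneg_of_mink_eq_zero hv h hvy) hvy

/-! ### Recurrence in the finite-volume quotient -/

/-- Poincaré recurrence on `H ⧸ Δ`, simultaneously for countably many translations. -/
theorem IsLatticeIn.exists_frequently_mem {H : Type*} [Group H] [TopologicalSpace H]
    [IsTopologicalGroup H] [SecondCountableTopology H] {Δ : Subgroup H} (hΔ : IsLatticeIn Δ)
    {ι : Type*} [Countable ι] (a : ι → H) :
    ∃ h : H, ∀ i, ∀ V ∈ 𝓝 (1 : H), ∃ᶠ n : ℕ in atTop, ∃ v ∈ V, h⁻¹ * v⁻¹ * a i ^ n * h ∈ Δ := by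
  let _ : MeasurableSpace (H ⧸ Δ) := borel _
  have : BorelSpace (H ⧸ Δ) := ⟨rfl⟩
  obtain ⟨μ, hμ, hinv⟩ := hΔ.exists_invariant_measure
  have hmp : ∀ h : H, MeasureTheory.MeasurePreserving (fun x : H ⧸ Δ => h • x) μ μ := by
    intro h
    have hm : Measurable fun x : H ⧸ Δ => h • x := (continuous_const_smul h).measurable
    refine ⟨hm, MeasureTheory.Measure.ext fun B hB => ?_⟩
    rw [MeasureTheory.Measure.map_apply hm hB]
    exact hinv h B hB
  have hae : ∀ᵐ x ∂μ, ∀ i, ∀ s ∈ 𝓝 x, ∃ᶠ n in atTop, (fun x : H ⧸ Δ => a i • x)^[n] x ∈ s :=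
    MeasureTheory.ae_all_iff.2 fun i => (hmp (a i)).conservative.ae_frequently_mem_of_mem_nhds
  obtain ⟨x, hx⟩ := hae.exists
  induction x using QuotientGroup.induction_on with | H h =>
  refine ⟨h, fun i V hV => ?_⟩
  -- `V h Δ` is a neighbourhood of `h Δ`, so a return at time `n` yields `v h Δ = (a i)ⁿ h Δ` with
  -- `v ∈ V`.
  have hVh : (fun v => ((v * h : H) : H ⧸ Δ)) '' V ∈ 𝓝 ((h : H) : H ⧸ Δ) := by
    have ho : IsOpenMap fun v : H => ((v * h : H) : H ⧸ Δ) :=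
      QuotientGroup.isOpenMap_coe.comp (isOpenMap_mul_right h)
    simpa using ho.image_mem_nhds hV
  refine (hx i _ hVh).mono fun n hn => ?_
  obtain ⟨v, hv, hvn⟩ := hn
  refine ⟨v, hv, ?_⟩
  rw [smul_iterate] at hvn
  have : ((v * h : H) : H ⧸ Δ) = ((a i ^ n * h : H) : H ⧸ Δ) := hvn
  rw [QuotientGroup.eq] at this
  simpa [mul_assoc] using this

instance : SecondCountableTopology SL3R :=
  @TopologicalSpace.Subtype.secondCountableTopology (Fin 3 → Fin 3 → ℝ) _ {A | Matrix.det A = 1} inferInstance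

/-! ### Lorentz isometries and boosts -/

theorem diagonal_mulVec_eq_polar (v : Fin 3 → ℝ) :
    (diagonal ![1, 1, -1] : Matrix (Fin 3) (Fin 3) ℝ) *ᵥ v = polar v := by
  ext i; fin_cases i <;> simp [polar, mulVec_diagonal]

theorem mink_mulVec_of_mem_SO21 {A : SL3R} (hA : A ∈ SO21) (v w : Fin 3 → ℝ) :
    mink (A.1 *ᵥ v) (A.1 *ᵥ w) = mink v w := by
  have h : A.1ᵀ * diagonal ![1, 1, -1] * A.1 = diagonal ![1, 1, -1] := hA
  rw [← dotProduct_polar, ← dotProduct_polar v, ← diagonal_mulVec_eq_polar,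
    ← diagonal_mulVec_eq_polar w]
  conv_rhs => rw [← h]
  rw [← mulVec_mulVec, ← mulVec_mulVec, dotProduct_mulVec v, vecMul_transpose]

theorem rankOne_mul_rankOne (α a c b : Fin 3 → ℝ) :
    rankOne α a * rankOne c b = mink a c • rankOne α b := by
  refine ext_of_mulVec_single fun i => ?_
  rw [← mulVec_mulVec, smul_mulVec, rankOne_mulVec, rankOne_mulVec, rankOne_mulVec,
    mink_smul_right, mul_smul, smul_comm]

theorem conj_rankOne {r : SL3R} (hr : r ∈ SO21) (a b : Fin 3 → ℝ) :
    r.1 * rankOne a b * (r⁻¹).1 = rankOne (r.1 *ᵥ a) (r.1 *ᵥ b) := by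
  refine ext_of_mulVec_single fun i => ?_
  have h : r.1 * (r⁻¹).1 = 1 := by
    rw [← Matrix.SpecialLinearGroup.coe_mul, mul_inv_cancel, Matrix.SpecialLinearGroup.coe_one]
  rw [← mulVec_mulVec, ← mulVec_mulVec, rankOne_mulVec, rankOne_mulVec, mulVec_smul,
    ← mink_mulVec_of_mem_SO21 hr, mulVec_mulVec _ r.1, h, one_mulVec]

/-- The Lorentz boost with eigenvalues `c`, `1`, `c⁻¹`. -/
noncomputable def boost (c : ℝ) : Matrix (Fin 3) (Fin 3) ℝ :=
  !![(c + c⁻¹) / 2, 0, (c - c⁻¹) / 2; 0, 1, 0; (c - c⁻¹) / 2, 0, (c + c⁻¹) / 2]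

theorem boost_mul (c d : ℝ) : boost c * boost d = boost (c * d) := by
  ext i j
  fin_cases i <;> fin_cases j <;> simp [boost, Matrix.mul_apply, Fin.sum_univ_three] <;> ring

theorem boost_two_pow (n : ℕ) : boost 2 ^ n = boost (2 ^ n) := by
  induction n with
  | zero => ext i j; fin_cases i <;> fin_cases j <;> norm_num [boost]
  | succ n ih => rw [pow_succ, ih, boost_mul, pow_succ]

theorem tendsto_boost : Tendsto (fun n : ℕ => ((2 : ℝ) ^ n)⁻¹ • boost (2 ^ n)) atTop
    (𝓝 ((1 / 2 : ℝ) • rankOne ![1, 0, 1] ![1, 0, -1])) := by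
  let B : ℝ → Matrix (Fin 3) (Fin 3) ℝ := fun t =>
    !![(1 + t ^ 2) / 2, 0, (1 - t ^ 2) / 2; 0, t, 0; (1 - t ^ 2) / 2, 0, (1 + t ^ 2) / 2]
  have hB : Continuous B := by
    refine continuous_matrix fun i j => ?_
    fin_cases i <;> fin_cases j <;> simp [B] <;> fun_prop
  have hB0 : (1 / 2 : ℝ) • rankOne ![1, 0, 1] ![1, 0, -1] = B 0 := by
    ext i j
    fin_cases i <;> fin_cases j <;> simp [B, rankOne, polar, vecMulVec]
  have hBn : ∀ n : ℕ, ((2 : ℝ) ^ n)⁻¹ • boost (2 ^ n) = B ((2 ^ n)⁻¹) := by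
    intro n
    have : (2 : ℝ) ^ n ≠ 0 := by positivity
    ext i j
    fin_cases i <;> fin_cases j <;> simp [B, boost] <;> field_simp
  simp only [hBn, hB0]
  refine (hB.tendsto 0).comp (tendsto_inv_atTop_zero.comp ?_)
  exact tendsto_pow_atTop_atTop_of_one_lt (by norm_num)

/-- The boost with eigenvalues `2`, `1`, `1 / 2`, as an element of `SO(2, 1)`. -/
noncomputable def boostTwo : SL3R := ⟨boost 2, by
  simp [boost, det_fin_three]; norm_num⟩

theorem boostTwo_mem : boostTwo ∈ SO21 := by
  change (boost 2)ᵀ * diagonal ![1, 1, -1] * boost 2 = diagonal ![1, 1, -1]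
  ext i j
  fin_cases i <;> fin_cases j <;>
    simp [boost, Matrix.mul_apply, Fin.sum_univ_three, diagonal] <;> norm_num

theorem exists_mem_SO21_rotation {p q : ℝ} (h : p ^ 2 + q ^ 2 = 1) :
    ∃ r ∈ SO21, ∀ v : Fin 3 → ℝ, r.1 *ᵥ v = ![p * v 0 - q * v 1, q * v 0 + p * v 1, v 2] := by
  refine ⟨⟨!![p, -q, 0; q, p, 0; 0, 0, 1], ?_⟩, ?_, fun v => ?_⟩
  · simp [det_fin_three]; linarith
  · change (!![p, -q, 0; q, p, 0; 0, 0, 1])ᵀ * diagonal ![1, 1, -1]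
      * !![p, -q, 0; q, p, 0; 0, 0, 1] = diagonal ![1, 1, -1]
    ext i j
    fin_cases i <;> fin_cases j <;>
      simp [Matrix.mul_apply, Fin.sum_univ_three, diagonal] <;> linarith
  · ext i
    fin_cases i <;> simp [mulVec, dotProduct, Fin.sum_univ_three]
    ring

/-! ### Rank one limits of the lattice -/

/-- Multiples of the matrices in `SO(2, 1) ∩ g⁻¹ Γ g`. -/
def isometryMultiples (Γ : Subgroup SL3R) (g : SL3R) : Set (Matrix (Fin 3) (Fin 3) ℝ) :=
  {M | ∃ (c : ℝ) (δ : SL3R), δ ∈ SO21 ∧ g * δ * g⁻¹ ∈ Γ ∧ M = c • δ.1}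

theorem mul_mem_closure_isometryMultiples {Γ : Subgroup SL3R} {g : SL3R}
    {M N : Matrix (Fin 3) (Fin 3) ℝ} (hM : M ∈ closure (isometryMultiples Γ g))
    (hN : N ∈ closure (isometryMultiples Γ g)) : M * N ∈ closure (isometryMultiples Γ g) := by
  refine map_mem_closure₂ continuous_mul hM hN ?_
  rintro _ ⟨c, δ, hδ, hδΓ, rfl⟩ _ ⟨d, ε, hε, hεΓ, rfl⟩
  refine ⟨c * d, δ * ε, mul_mem hδ hε, ?_, ?_⟩
  · have : g * (δ * ε) * g⁻¹ = (g * δ * g⁻¹) * (g * ε * g⁻¹) := by group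
    rw [this]; exact mul_mem hδΓ hεΓ
  · rw [Matrix.SpecialLinearGroup.coe_mul, smul_mul_smul_comm]

theorem smul_mem_closure_isometryMultiples {Γ : Subgroup SL3R} {g : SL3R}
    {M : Matrix (Fin 3) (Fin 3) ℝ} (hM : M ∈ closure (isometryMultiples Γ g)) (c : ℝ) :
    c • M ∈ closure (isometryMultiples Γ g) := by
  refine map_mem_closure (continuous_const_smul c) hM ?_
  rintro _ ⟨d, δ, hδ, hδΓ, rfl⟩
  exact ⟨c * d, δ, hδ, hδΓ, smul_smul _ _ _⟩

/-- Normalized powers of a boost tend to a multiple of `E`. Recurrence along its conjugate by `k`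
puts those powers in the lattice, up to a small error and the fixed base point `x`. -/
theorem conj_rankOne_mem_closure {Γ : Subgroup SL3R} {g : SL3R}
    (hL : IsLatticeIn (Γ.subgroupOf (SO21.map (MulAut.conj g).toMonoidHom)))
    {r : SL3R} (hr : r ∈ SO21) :
    r.1 * rankOne ![1, 0, 1] ![1, 0, -1] * (r⁻¹).1 ∈ closure (isometryMultiples Γ g) := by
  set E := rankOne ![1, 0, 1] ![1, 0, -1] with hE
  let H := SO21.map (MulAut.conj g).toMonoidHom
  have hH : ∀ x ∈ SO21, g * x * g⁻¹ ∈ H := fun x hx => ⟨x, hx, rfl⟩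
  have hH' : ∀ x ∈ H, g⁻¹ * x * g ∈ SO21 := by
    rintro _ ⟨x, hx, rfl⟩
    have : g⁻¹ * (g * x * g⁻¹) * g = x := by group
    change g⁻¹ * (g * x * g⁻¹) * g ∈ SO21
    rwa [this]
  have : SecondCountableTopology SO21 := TopologicalSpace.Subtype.secondCountableTopology _
  have : SecondCountableTopology H := TopologicalSpace.Subtype.secondCountableTopology _
  -- Almost every base point recurs for countably many conjugates at once. A dense set of them
  -- suffices, because the desired membership is closed in `k`.
  obtain ⟨D, hDc, hDd⟩ := TopologicalSpace.exists_countable_dense SO21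
  have := hDc.to_subtype
  obtain ⟨h, hh⟩ := hL.exists_frequently_mem (fun k : D =>
    (⟨g * (k.1.1 * boostTwo * k.1.1⁻¹) * g⁻¹,
      hH _ (mul_mem (mul_mem k.1.2 boostTwo_mem) (inv_mem k.1.2))⟩ : H))
  set x : SL3R := g⁻¹ * h.1 * g with hx
  have hxS : x ∈ SO21 := hH' _ h.2
  have hcl : IsClosed {k : SO21 | (x⁻¹ * k.1).1 * E * (k.1⁻¹ * x).1 ∈
      closure (isometryMultiples Γ g)} := by
    refine isClosed_closure.preimage ?_
    have hv : Continuous fun A : SL3R => A.1 := continuous_subtype_val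
    exact ((hv.comp (continuous_const.mul continuous_subtype_val)).mul continuous_const).mul
      (hv.comp (continuous_subtype_val.inv.mul continuous_const))
  have hDK : D ⊆ {k : SO21 | (x⁻¹ * k.1).1 * E * (k.1⁻¹ * x).1 ∈
      closure (isometryMultiples Γ g)} := by
    intro k hk
    rw [Set.mem_ofPred_eq]
    suffices hs : (x⁻¹ * k.1).1 * ((1 / 2 : ℝ) • E) * (k.1⁻¹ * x).1 ∈
        closure (isometryMultiples Γ g) by
      have := smul_mem_closure_isometryMultiples hs 2
      rwa [Matrix.mul_smul, Matrix.smul_mul, smul_smul, mul_one_div_cancel two_ne_zero,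
        one_smul] at this
    rw [mem_closure_iff_nhds]
    intro t ht
    -- The lattice element given by a return, with the error `v` and the normalized boost power
    -- treated as independent variables.
    let Ψ : H × Matrix (Fin 3) (Fin 3) ℝ → Matrix (Fin 3) (Fin 3) ℝ := fun P =>
      (x⁻¹ * (g⁻¹ * P.1.1⁻¹ * g) * k.1).1 * P.2 * (k.1⁻¹ * x).1
    have hΨ : Continuous Ψ := by
      have hv : Continuous fun A : SL3R => A.1 := continuous_subtype_val
      refine Continuous.mul (Continuous.mul (hv.comp ?_) continuous_snd) continuous_const
      exact (continuous_const.mul ((continuous_const.mul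
        (continuous_subtype_val.comp continuous_fst).inv).mul continuous_const)).mul
          continuous_const
    have hΨ1 : Ψ (1, (1 / 2 : ℝ) • E) = (x⁻¹ * k.1).1 * ((1 / 2 : ℝ) • E) * (k.1⁻¹ * x).1 := by
      have e : x⁻¹ * (g⁻¹ * ((1 : H) : SL3R)⁻¹ * g) * k.1 = x⁻¹ * k.1 := by
        rw [OneMemClass.coe_one]; group
      simp only [Ψ, e]
    rw [← hΨ1] at ht
    have hev : ∀ᶠ P : H × ℕ in 𝓝 1 ×ˢ atTop,
        Ψ (P.1, ((2 : ℝ) ^ P.2)⁻¹ • boost (2 ^ P.2)) ∈ t := by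
      have hl : Tendsto (fun P : H × ℕ => (P.1, ((2 : ℝ) ^ P.2)⁻¹ • boost (2 ^ P.2)))
          (𝓝 1 ×ˢ atTop) (𝓝 (1, (1 / 2 : ℝ) • E)) := by
        rw [nhds_prod_eq]
        exact tendsto_fst.prodMk (tendsto_boost.comp tendsto_snd)
      exact ((hΨ.tendsto _).comp hl).eventually ht
    obtain ⟨p, hp, q, hq, hpq⟩ := eventually_prod_iff.1 hev
    obtain ⟨n, ⟨v, hv, hvn⟩, hqn⟩ := ((hh ⟨k, hk⟩ _ hp).and_eventually hq).exists
    refine ⟨_, hpq hv hqn, (2 ^ n)⁻¹,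
      x⁻¹ * (g⁻¹ * v.1⁻¹ * g) * (k.1 * boostTwo ^ n * k.1⁻¹) * x, ?_, ?_, ?_⟩
    · exact mul_mem (mul_mem (mul_mem (inv_mem hxS) (hH' _ (inv_mem v.2)))
        (mul_mem (mul_mem k.2 (pow_mem boostTwo_mem n)) (inv_mem k.2))) hxS
    · rw [Subgroup.mem_subgroupOf] at hvn
      convert hvn using 1
      have e : (g * (k.1 * boostTwo * k.1⁻¹) * g⁻¹) ^ n
          = g * (k.1 * boostTwo ^ n * k.1⁻¹) * g⁻¹ := by rw [conj_pow, conj_pow]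
      simp only [Subgroup.coe_mul, Subgroup.coe_inv, Subgroup.coe_pow, e, hx]
      group
    · have e : (boostTwo ^ n).1 = boost (2 ^ n) := by
        rw [Matrix.SpecialLinearGroup.coe_pow, ← boost_two_pow]; rfl
      simp only [Ψ, Matrix.SpecialLinearGroup.coe_mul, e, Matrix.mul_smul, Matrix.smul_mul,
        Matrix.mul_assoc]
  have huniv := hcl.closure_subset_iff.2 hDK
  have hxr : x * r ∈ SO21 := mul_mem hxS hr
  -- Taking `k = x r` cancels the unknown base point.
  have := huniv (hDd ⟨x * r, hxr⟩)
  have e : x⁻¹ * (x * r) = r := by group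
  have e' : (x * r)⁻¹ * x = r⁻¹ := by group
  rwa [Set.mem_ofPred_eq, e, e'] at this

/-- The closure of the multiples of a lattice in `SO(2, 1)` contains all the rank one
endomorphisms built from null vectors. -/
theorem rankOne_mem_closure {Γ : Subgroup SL3R} {g : SL3R}
    (hL : IsLatticeIn (Γ.subgroupOf (SO21.map (MulAut.conj g).toMonoidHom)))
    {α β : Fin 3 → ℝ} (hα : IsNull α) (hβ : IsNull β) :
    rankOne α β ∈ closure (isometryMultiples Γ g) := by
  -- `E` is `rankOne e (polar e)` for `e = (1, 0, 1)`. Rotations about the time axis commute with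
  -- `polar` and carry `e` to every null direction.
  have hpol : ∀ α, IsNull α → rankOne α (polar α) ∈ closure (isometryMultiples Γ g) := by
    intro α hα
    have h2 : α 2 ≠ 0 := by
      intro h2
      have := hα.2
      simp only [mink, h2] at this
      apply hα.1
      ext i; fin_cases i <;> simp [h2] <;> nlinarith
    obtain ⟨r, hr, hrv⟩ := exists_mem_SO21_rotation (p := α 0 / α 2) (q := α 1 / α 2) (by
      have := hα.2
      simp only [mink] at this
      field_simp; linarith)
    have := smul_mem_closure_isometryMultiples (conj_rankOne_mem_closure hL hr) (α 2 * α 2)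
    rw [conj_rankOne hr, hrv, hrv] at this
    convert this using 1
    ext i j
    fin_cases i <;> fin_cases j <;> simp [rankOne, polar, vecMulVec] <;> field_simp
  have hβ' : IsNull (polar β) := ⟨polar_ne_zero hβ.1, (mink_polar_polar β β).trans hβ.2⟩
  -- Composing through a generic null `c` decouples source and target: the product of three such
  -- maps is a nonzero multiple of `rankOne α β`.
  obtain ⟨c, hc, hcα, hcβ⟩ := exists_isNull_mink_ne_zero (polar_ne_zero hα.1) hβ.1
  have h1 := mul_mem_closure_isometryMultiples (mul_mem_closure_isometryMultiples (hpol α hα)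
    (hpol c hc)) (hpol _ hβ')
  rw [rankOne_mul_rankOne, Matrix.smul_mul, rankOne_mul_rankOne, mink_polar_polar, polar_polar,
    smul_smul] at h1
  have h2 := smul_mem_closure_isometryMultiples h1 (mink (polar α) c * mink c β)⁻¹
  rwa [smul_smul, inv_mul_cancel₀, one_smul] at h2
  exact mul_ne_zero (by rwa [mink_comm]) hcβ

/-! ### Consequences of Zariski density -/

/-- The sum is a polynomial in the entries of `γ`. This shape covers the Lorentzian norm of a vector
moved by a conjugate of `γ` or by its transpose. -/
theorem IsZariskiDense.sum_sq_eq_zero {Γ : Subgroup SL3R} (hZ : IsZariskiDense Γ)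
    (e : Fin 3 → ℝ) (u w : Fin 3 → Fin 3 → ℝ)
    (h : ∀ γ ∈ Γ, ∑ i, e i * (u i ⬝ᵥ γ.1 *ᵥ w i) ^ 2 = 0) (γ : SL3R) :
    ∑ i, e i * (u i ⬝ᵥ γ.1 *ᵥ w i) ^ 2 = 0 := by
  let f : MvPolynomial (Fin 3 × Fin 3) ℝ := ∑ i, MvPolynomial.C (e i) *
    (∑ a, MvPolynomial.C (u i a) * ∑ b, MvPolynomial.X (a, b) * MvPolynomial.C (w i b)) ^ 2
  have hf : ∀ γ : SL3R, MvPolynomial.eval (fun ij => γ.1 ij.1 ij.2) f =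
      ∑ i, e i * (u i ⬝ᵥ γ.1 *ᵥ w i) ^ 2 := by
    intro γ
    simp only [f, map_sum, map_mul, map_pow, MvPolynomial.eval_C, MvPolynomial.eval_X,
      dotProduct, mulVec]
  rw [← hf]
  exact hZ f (fun γ hγ => (hf γ).trans (h γ hγ)) γ

theorem mink_self_eq_sum (v : Fin 3 → ℝ) :
    mink v v = ∑ i, (![1, 1, -1] : Fin 3 → ℝ) i * v i ^ 2 := by
  simp [mink, Fin.sum_univ_three]; ring

theorem coe_mul_coe_inv (γ : SL3R) : γ.1 * (γ⁻¹).1 = 1 := by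
  rw [← Matrix.SpecialLinearGroup.coe_mul, mul_inv_cancel, Matrix.SpecialLinearGroup.coe_one]

theorem coe_inv_mul_coe (γ : SL3R) : (γ⁻¹).1 * γ.1 = 1 := by
  rw [← Matrix.SpecialLinearGroup.coe_mul, inv_mul_cancel, Matrix.SpecialLinearGroup.coe_one]

theorem coe_eq_conj (g γ : SL3R) : γ.1 = (g⁻¹).1 * ((g * γ * g⁻¹).1 * g.1) := by
  have e : γ = g⁻¹ * ((g * γ * g⁻¹) * g) := by group
  exact congrArg Subtype.val e

/-- Some element of a Zariski-dense group moves a null vector to a spacelike one, in any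
representation `τ` whose matrix coefficients are linear in the matrix entries. -/
theorem IsZariskiDense.exists_spacelike {Γ : Subgroup SL3R} (hZ : IsZariskiDense Γ) (g : SL3R)
    (τ : SL3R → Matrix (Fin 3) (Fin 3) ℝ) (hτ : ∀ γ, τ γ⁻¹ * τ γ = 1) (u w : Fin 3 → Fin 3 → ℝ)
    (huw : ∀ γ i, (τ γ *ᵥ ![1, 0, 1]) i = u i ⬝ᵥ (g * γ * g⁻¹).1 *ᵥ w i)
    (hd : ∃ γ, mink (τ γ *ᵥ ![1, 0, 1]) (τ γ *ᵥ ![1, 0, 1]) ≠ 0) :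
    ∃ γ β, g * γ * g⁻¹ ∈ Γ ∧ IsNull β ∧ 0 < mink (τ γ *ᵥ β) (τ γ *ᵥ β) := by
  by_contra! hcon
  have hn : IsNull ![1, 0, 1] := ⟨fun h => by simpa using congrFun h 0, by simp [mink]⟩
  have hsum : ∀ γ, mink (τ γ *ᵥ ![1, 0, 1]) (τ γ *ᵥ ![1, 0, 1]) =
      ∑ i, (![1, 1, -1] : Fin 3 → ℝ) i * (u i ⬝ᵥ (g * γ * g⁻¹).1 *ᵥ w i) ^ 2 := by
    intro γ
    rw [mink_self_eq_sum]
    exact Finset.sum_congr rfl fun i _ => by rw [huw]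
  obtain ⟨d, hd⟩ := hd
  refine hd ?_
  rw [hsum]
  refine hZ.sum_sq_eq_zero _ _ _ (fun γ hγ => ?_) _
  have e : g * (g⁻¹ * γ * g) * g⁻¹ = γ := by group
  have e' : g * (g⁻¹ * γ * g)⁻¹ * g⁻¹ = γ⁻¹ := by group
  have h0 := hsum (g⁻¹ * γ * g)
  rw [e] at h0
  rw [← h0]
  refine mink_mulVec_eq_zero (hτ _) (fun v hv => hcon _ v ?_ hv) (fun v hv => hcon _ v ?_ hv) hn
  · rwa [e]
  · rw [e']; exact inv_mem hγ

theorem exists_mink_diagonal_ne_zero : ∃ γ : SL3R, γ.1ᵀ = γ.1 ∧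
    mink (γ.1 *ᵥ ![1, 0, 1]) (γ.1 *ᵥ ![1, 0, 1]) ≠ 0 := by
  refine ⟨⟨diagonal ![2, 1, 1 / 2], ?_⟩, diagonal_transpose _, ?_⟩
  · simp [det_diagonal, Fin.prod_univ_three]
  · simp [mink, mulVec_diagonal]; norm_num

theorem IsZariskiDense.exists_spacelike_mulVec {Γ : Subgroup SL3R} (hZ : IsZariskiDense Γ)
    (g : SL3R) : ∃ (γ : SL3R) (β : Fin 3 → ℝ), g * γ * g⁻¹ ∈ Γ ∧ IsNull β ∧
      0 < mink (γ.1 *ᵥ β) (γ.1 *ᵥ β) := by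
  refine hZ.exists_spacelike g (fun γ => γ.1) coe_inv_mul_coe
    (fun i => (g⁻¹).1 i) (fun _ => g.1 *ᵥ ![1, 0, 1]) (fun γ i => ?_) ?_
  · conv_lhs => rw [coe_eq_conj g γ]
    rw [← mulVec_mulVec, ← mulVec_mulVec]
    rfl
  · obtain ⟨γ, -, h⟩ := exists_mink_diagonal_ne_zero
    exact ⟨γ, h⟩

theorem IsZariskiDense.exists_spacelike_transpose_mulVec {Γ : Subgroup SL3R}
    (hZ : IsZariskiDense Γ) (g : SL3R) : ∃ (γ : SL3R) (β : Fin 3 → ℝ), g * γ * g⁻¹ ∈ Γ ∧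
      IsNull β ∧ 0 < mink (γ.1ᵀ *ᵥ β) (γ.1ᵀ *ᵥ β) := by
  refine hZ.exists_spacelike g (fun γ => γ.1ᵀ) (fun γ => ?_)
    (fun _ => ![1, 0, 1] ᵥ* (g⁻¹).1) (fun i => g.1ᵀ i) (fun γ i => ?_) ?_
  · rw [← transpose_mul, coe_mul_coe_inv, transpose_one]
  · conv_lhs => rw [coe_eq_conj g γ]
    rw [mulVec_transpose, ← vecMul_vecMul, ← vecMul_vecMul, dotProduct_mulVec]
    rfl
  · obtain ⟨γ, hγ, h⟩ := exists_mink_diagonal_ne_zero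
    exact ⟨γ, by rwa [hγ]⟩

/-! ### Back to the group and its flags -/

/-- The action of `γ` on the poles of projective lines with respect to the light cone. -/
noncomputable def contragredient (γ : SL3R) : Matrix (Fin 3) (Fin 3) ℝ :=
  diagonal ![1, 1, -1] * (γ⁻¹).1ᵀ * diagonal ![1, 1, -1]

theorem contragredient_mulVec (γ : SL3R) (v : Fin 3 → ℝ) :
    contragredient γ *ᵥ v = polar ((γ⁻¹).1ᵀ *ᵥ polar v) := by
  rw [contragredient, ← mulVec_mulVec, ← mulVec_mulVec, diagonal_mulVec_eq_polar,
    diagonal_mulVec_eq_polar]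

theorem contragredient_mul_mulVec (γ δ : SL3R) (v : Fin 3 → ℝ) :
    contragredient (γ * δ) *ᵥ v = contragredient γ *ᵥ contragredient δ *ᵥ v := by
  simp only [contragredient_mulVec, polar_polar, _root_.mul_inv_rev, Matrix.SpecialLinearGroup.coe_mul,
    transpose_mul, mulVec_mulVec]

theorem contragredient_of_mem_SO21 {δ : SL3R} (hδ : δ ∈ SO21) : contragredient δ = δ.1 := by
  have h : (δ⁻¹).1ᵀ * diagonal ![1, 1, -1] * (δ⁻¹).1 = diagonal ![1, 1, -1] := inv_mem hδ
  have hJ : (diagonal ![1, 1, -1] : Matrix (Fin 3) (Fin 3) ℝ) * diagonal ![1, 1, -1] = 1 := by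
    ext i j; fin_cases i <;> fin_cases j <;> simp
  have h' : (δ⁻¹).1ᵀ * diagonal ![1, 1, -1] = diagonal ![1, 1, -1] * δ.1 := by
    conv_rhs => rw [← h]
    rw [Matrix.mul_assoc _ (δ⁻¹).1, coe_inv_mul_coe, Matrix.mul_one]
  rw [contragredient, Matrix.mul_assoc, h', ← Matrix.mul_assoc, hJ, Matrix.one_mul]

theorem mink_mulVec_contragredient (γ : SL3R) (v w : Fin 3 → ℝ) :
    mink (γ.1 *ᵥ v) (contragredient γ *ᵥ w) = mink v w := by
  rw [contragredient_mulVec, mink_polar, dotProduct_mulVec, vecMul_transpose, mulVec_mulVec,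
    coe_inv_mul_coe, one_mulVec, dotProduct_polar]

/-- The elements of `g⁻¹ Γ g`, acting on points and on poles of lines. -/
def conjPairs (Γ : Subgroup SL3R) (g : SL3R) :
    Set (Matrix (Fin 3) (Fin 3) ℝ × Matrix (Fin 3) (Fin 3) ℝ) :=
  {P | ∃ γ, g * γ * g⁻¹ ∈ Γ ∧ P = (γ.1, contragredient γ)}

theorem contragredient_conjPairs (Γ : Subgroup SL3R) (g : SL3R) :
    Contragredient (conjPairs Γ g) := by
  rintro _ ⟨γ, -, rfl⟩ v w
  exact mink_mulVec_contragredient γ v w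

theorem hasRankOneLimits_conjPairs {Γ : Subgroup SL3R} {g : SL3R}
    (hL : IsLatticeIn (Γ.subgroupOf (SO21.map (MulAut.conj g).toMonoidHom))) :
    HasRankOneLimits (conjPairs Γ g) := by
  intro α β hα hβ
  refine closure_mono ?_ (rankOne_mem_closure hL hα hβ)
  rintro _ ⟨c, δ, hδ, hδΓ, rfl⟩
  exact ⟨c, δ.1, ⟨δ, hδΓ, by rw [contragredient_of_mem_SO21 hδ]⟩, rfl⟩

/-- The line with pole `x = polar (γᵀ β)` is mapped by `γ` to the tangent line with pole `polar β`;
its pole being spacelike, it crosses the conic. -/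
theorem IsZariskiDense.exists_isTransverse {Γ : Subgroup SL3R} (hZ : IsZariskiDense Γ)
    (g : SL3R) : ∃ P ∈ conjPairs Γ g, IsTransverse P.1 P.2 := by
  obtain ⟨γ, β, hγ, hβ, hpos⟩ := hZ.exists_spacelike_transpose_mulVec g
  have e : contragredient γ *ᵥ polar (γ.1ᵀ *ᵥ β) = polar β := by
    rw [contragredient_mulVec, polar_polar, mulVec_mulVec, ← transpose_mul, coe_mul_coe_inv,
      transpose_one, one_mulVec]
  refine ⟨_, ⟨γ, hγ, rfl⟩, polar (γ.1ᵀ *ᵥ β), (γ⁻¹).1 *ᵥ polar β, ?_, ?_, ?_⟩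
  · rw [e]; exact ⟨polar_ne_zero hβ.1, (mink_polar_polar β β).trans hβ.2⟩
  · rw [e, mulVec_mulVec, coe_mul_coe_inv, one_mulVec]
  · rwa [mink_polar_polar]

theorem IsZariskiDense.exists_isTransverse_swap {Γ : Subgroup SL3R} (hZ : IsZariskiDense Γ)
    (g : SL3R) : ∃ P ∈ conjPairs Γ g, IsTransverse P.2 P.1 := by
  obtain ⟨γ, β, hγ, hβ, hpos⟩ := hZ.exists_spacelike_mulVec g
  have hγ' : g * γ⁻¹ * g⁻¹ ∈ Γ := by
    have : g * γ⁻¹ * g⁻¹ = (g * γ * g⁻¹)⁻¹ := by group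
    rw [this]; exact inv_mem hγ
  have e : (γ⁻¹).1 *ᵥ γ.1 *ᵥ β = β := by rw [mulVec_mulVec, coe_inv_mul_coe, one_mulVec]
  obtain ⟨y, hy⟩ := mulVec_surjective_right (mink_mulVec_contragredient γ⁻¹) β
  exact ⟨_, ⟨γ⁻¹, hγ', rfl⟩, γ.1 *ᵥ β, y, by rwa [e], by rw [e]; exact hy, hpos⟩

theorem isInvariantCone_closure_orbit (Γ : Subgroup SL3R) (g : SL3R) (v₀ y₀ : Fin 3 → ℝ) :
    IsInvariantCone (conjPairs Γ g) (closure {p : (Fin 3 → ℝ) × (Fin 3 → ℝ) |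
      ∃ (γ : SL3R) (c d : ℝ), g * γ * g⁻¹ ∈ Γ ∧
        p = (c • (γ.1 *ᵥ v₀), d • (contragredient γ *ᵥ y₀))}) where
  closed := isClosed_closure
  smul a b v y h := by
    refine map_mem_closure (f := fun p : (Fin 3 → ℝ) × (Fin 3 → ℝ) => (a • p.1, b • p.2))
      (by fun_prop) h ?_
    rintro _ ⟨γ, c, d, hγ, rfl⟩
    exact ⟨γ, a * c, b * d, hγ, by simp only [smul_smul]⟩
  map := by
    rintro _ ⟨δ, hδ, rfl⟩ v y h
    refine map_mem_closure (f := fun p : (Fin 3 → ℝ) × (Fin 3 → ℝ) =>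
      (δ.1 *ᵥ p.1, contragredient δ *ᵥ p.2)) (by fun_prop) h ?_
    rintro _ ⟨γ, c, d, hγ, rfl⟩
    refine ⟨δ * γ, c, d, ?_, ?_⟩
    · have : g * (δ * γ) * g⁻¹ = (g * δ * g⁻¹) * (g * γ * g⁻¹) := by group
      rw [this]; exact mul_mem hδ hγ
    · simp only [mulVec_smul, contragredient_mul_mulVec, Matrix.SpecialLinearGroup.coe_mul,
        mulVec_mulVec]

theorem ne_zero_mulVec (γ : SL3R) {v : Fin 3 → ℝ} (hv : v ≠ 0) : γ.1 *ᵥ v ≠ 0 := fun h =>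
  hv (by rw [← one_mulVec v, ← coe_inv_mul_coe γ, ← mulVec_mulVec, h, mulVec_zero])

theorem ne_zero_transpose_mulVec (γ : SL3R) {v : Fin 3 → ℝ} (hv : v ≠ 0) :
    γ.1ᵀ *ᵥ v ≠ 0 :=
  ne_zero_mulVec γ.transpose hv

/-- Any pair of orthogonal vectors is a limit of representatives of the flags in an orbit. -/
theorem mem_closure_orbit {Γ : Subgroup SL3R} (hZ : IsZariskiDense Γ) {g : SL3R}
    (hL : IsLatticeIn (Γ.subgroupOf (SO21.map (MulAut.conj g).toMonoidHom)))
    {a b v w : Fin 3 → ℝ} (ha : a ≠ 0) (hb : b ≠ 0) (hv : v ≠ 0) (hw : w ≠ 0)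
    (hvw : v ⬝ᵥ w = 0) :
    (v, w) ∈ closure {p : (Fin 3 → ℝ) × (Fin 3 → ℝ) | ∃ γ ∈ Γ, ∃ c d : ℝ,
      p = (c • (γ.1 *ᵥ a), d • ((γ⁻¹).1ᵀ *ᵥ b))} := by
  have hF := isInvariantCone_closure_orbit Γ g ((g⁻¹).1 *ᵥ a) (polar (g.1ᵀ *ᵥ b))
  have hmem := hF.mem_of_mink_eq_zero (contragredient_conjPairs Γ g)
    (hasRankOneLimits_conjPairs hL) (hZ.exists_isTransverse g) (hZ.exists_isTransverse_swap g)
    (v₀ := (g⁻¹).1 *ᵥ a) (y₀ := polar (g.1ᵀ *ᵥ b))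
    (subset_closure ⟨1, 1, 1, by simp, by simp [contragredient_mulVec, polar_polar]⟩)
    (ne_zero_mulVec _ ha) (polar_ne_zero (ne_zero_transpose_mulVec _ hb))
    (v := (g⁻¹).1 *ᵥ v) (y := polar (g.1ᵀ *ᵥ w))
    (ne_zero_mulVec _ hv) (polar_ne_zero (ne_zero_transpose_mulVec _ hw))
    (by rw [mink_polar, dotProduct_mulVec, vecMul_transpose, mulVec_mulVec, coe_mul_coe_inv,
      one_mulVec, hvw])
  let T : (Fin 3 → ℝ) × (Fin 3 → ℝ) → (Fin 3 → ℝ) × (Fin 3 → ℝ) :=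
    fun p => (g.1 *ᵥ p.1, (g⁻¹).1ᵀ *ᵥ polar p.2)
  have hT : Continuous T :=
    (continuous_const.matrix_mulVec continuous_fst).prodMk
      (continuous_const.matrix_mulVec (continuous_polar.comp continuous_snd))
  have hTvw : T ((g⁻¹).1 *ᵥ v, polar (g.1ᵀ *ᵥ w)) = (v, w) := by
    simp only [T, polar_polar, mulVec_mulVec, coe_mul_coe_inv, ← transpose_mul, transpose_one,
      one_mulVec]
  rw [← hTvw]
  refine map_mem_closure hT hmem ?_
  rintro _ ⟨γ, c, d, hγ, rfl⟩
  refine ⟨_, hγ, c, d, ?_⟩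
  have e : (g * γ * g⁻¹)⁻¹ = g * γ⁻¹ * g⁻¹ := by group
  simp only [T, e, polar_smul, contragredient_mulVec, polar_polar, mulVec_smul, mulVec_mulVec,
    Matrix.SpecialLinearGroup.coe_mul, transpose_mul, Matrix.mul_assoc]

theorem continuous_projectivization_mk {X : Type*} [TopologicalSpace X] {f : X → Fin 3 → ℝ}
    (hf : Continuous f) (h : ∀ x, f x ≠ 0) :
    Continuous fun x => Projectivization.mk ℝ (f x) (h x) := by
  have hc : Continuous fun v : {v : Fin 3 → ℝ // v ≠ 0} => Projectivization.mk ℝ v.1 v.2 :=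
    continuous_coinduced_rng
  exact hc.comp (hf.subtype_mk h)

theorem mainTheorem11 (Γ : Subgroup SL3R) (hΓ : DiscreteTopology Γ) (hZ : IsZariskiDense Γ)
    (g : SL3R)
    (hL : IsLatticeIn (Γ.subgroupOf (SO21.map (MulAut.conj g).toMonoidHom))) :
    MulAction.IsMinimal Γ FlagR3 := by
  refine ⟨fun x y => ?_⟩
  obtain ⟨⟨p, l⟩, hpl⟩ := x
  obtain ⟨⟨q, m⟩, hqm⟩ := y
  induction p with | h a ha =>
  induction l with | h b hb =>
  induction q with | h v hv =>
  induction m with | h w hw =>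
  have hvw : v ⬝ᵥ w = 0 := (Projectivization.orthogonal_mk hv hw).1 hqm
  have hcl := mem_closure_orbit hZ hL ha hb hv hw hvw
  let R := {p : (Fin 3 → ℝ) × (Fin 3 → ℝ) // (p.1 ≠ 0 ∧ p.2 ≠ 0) ∧ p.1 ⬝ᵥ p.2 = 0}
  let f : R → FlagR3 := fun p =>
    ⟨(Projectivization.mk ℝ p.1.1 p.2.1.1, Projectivization.mk ℝ p.1.2 p.2.1.2),
      (Projectivization.orthogonal_mk p.2.1.1 p.2.1.2).2 p.2.2⟩
  have hf : Continuous f :=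
    ((continuous_projectivization_mk (continuous_fst.comp continuous_subtype_val) _).prodMk
      (continuous_projectivization_mk (continuous_snd.comp continuous_subtype_val) _)).subtype_mk _
  refine mem_closure_iff.2 fun U hU hyU => ?_
  obtain ⟨W, hW, hWU⟩ := isOpen_induced_iff.1 (hU.preimage hf)
  have hvwW : (v, w) ∈ W := by
    have : (⟨(v, w), ⟨hv, hw⟩, hvw⟩ : R) ∈ Subtype.val ⁻¹' W := by rw [hWU]; exact hyU
    exact this
  -- The scalars in the orbit cone may vanish, so `W` is cut down to pairs of nonzero vectors, which
  -- represent flags.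
  have hW' : IsOpen (W ∩ {p : (Fin 3 → ℝ) × (Fin 3 → ℝ) | p.1 ≠ 0 ∧ p.2 ≠ 0}) :=
    hW.inter ((isOpen_ne_fun continuous_fst continuous_const).inter
      (isOpen_ne_fun continuous_snd continuous_const))
  obtain ⟨_, ⟨hzW, hz1, hz2⟩, γ, hγ, c, d, rfl⟩ :=
    mem_closure_iff.1 hcl _ hW' ⟨hvwW, hv, hw⟩
  have hab : a ⬝ᵥ b = 0 := (Projectivization.orthogonal_mk ha hb).1 hpl
  have hz : (c • (γ.1 *ᵥ a)) ⬝ᵥ (d • ((γ⁻¹).1ᵀ *ᵥ b)) = 0 := by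
    rw [smul_dotProduct, dotProduct_smul, dotProduct_mulVec, vecMul_transpose, mulVec_mulVec,
      coe_inv_mul_coe, one_mulVec, hab, smul_zero, smul_zero]
  have hzU : (⟨_, ⟨hz1, hz2⟩, hz⟩ : R) ∈ f ⁻¹' U := by rw [← hWU]; exact hzW
  refine ⟨_, hzU, ⟨γ, hγ⟩, ?_⟩
  refine Subtype.ext (Prod.ext ?_ ?_)
  · change γ • Projectivization.mk ℝ a ha = _
    rw [Projectivization.smul_mk]
    refine ((Projectivization.mk_eq_mk_iff' ℝ _ _ _ _).2 ⟨c, rfl⟩).symm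
  · change (γ⁻¹).transpose • Projectivization.mk ℝ b hb = _
    rw [Projectivization.smul_mk]
    refine ((Projectivization.mk_eq_mk_iff' ℝ _ _ _ _).2 ⟨d, rfl⟩).symm
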